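/- Let $\mathrm{SU}(1,1)$ denote the group of all matrices $\begin{bmatrix} a & \overline{b}\\ b & \overline{a}\end{bmatrix}$ with $a,b\in\mathbb{C}$ and $|a|^2-|b|^2=1$. For every integer $d\ge 2$ there exist a constant $C_d>0$ and a function $\beta_d\colon[0,\infty)\to[0,\infty)$ with the following two properties. (1) For every $\begin{bmatrix} a & \overline{b}\\ b & \overline{a}\end{bmatrix}\in\mathrm{SU}(1,1)$, $$C_d^{-1}(\ln|a|)^{1/2}\ \le\ \beta_d(|b|)\ \le\ C_d(\ln|a|)^{1/2}.$$ (2) Whenever matrices $\begin{bmatrix} a_j & \overline{b_j}\\ b_j & \overline{a_j}\end{bmatrix}$ and $\begin{bmatrix} A_k & \overline{B_k}\\ B_k & \overline{A_k}\end{bmatrix}$ in $\mathrm{SU}(1,1)$, $j,k=0,1,\dots,d-1$, satisfy $$\begin{bmatrix} A_k & \overline{B_k}\\ B_k & \overline{A_k}\end{bmatrix}=\prod_{j=0}^{d-1}\begin{bmatrix} a_j & \overline{b_j}\,e^{-2\pi i jk/d}\\ b_j\,e^{2\pi i jk/d} & \overline{a_j}\end{bmatrix}\qquad(k=0,1,\dots,d-1),$$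 where the product is taken in ascending order of $j$ from left to right, then for every pair of conjugate exponents $1<p\le 2$ and $2\le q<\infty$, $\frac1p+\frac1q=1$, $$\Big(\frac1d\sum_{k=0}^{d-1}\beta_d(|B_k|)^q\Big)^{1/q}\ \le\ \Big(\sum_{j=0}^{d-1}\beta_d(|b_j|)^p\Big)^{1/p}.$$ -/

import Mathlib

open scoped NNReal ComplexConjugate

/-- The matrix with rows `(a, conj b)` and `(b, conj a)`. -/
def su11Matrix (a b : ℂ) : Matrix (Fin 2) (Fin 2) ℂ :=
  !![a, conj b; b, conj a]

/-- The group `SU(1,1)`, as a set of complex `2 × 2` matrices. -/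
def SU11 : Set (Matrix (Fin 2) (Fin 2) ℂ) :=
  {M | ∃ a b : ℂ, ‖a‖ ^ 2 - ‖b‖ ^ 2 = 1 ∧ M = su11Matrix a b}

/-- The matrix with rows `(a, conj b * exp (-2πijk/d))` and `(b * exp (2πijk/d), conj a)`. -/
noncomputable def twistedMatrix (d j k : ℕ) (a b : ℂ) : Matrix (Fin 2) (Fin 2) ℂ :=
  !![a, conj b * Complex.exp (-(2 * Real.pi * Complex.I * j * k / d));
     b * Complex.exp (2 * Real.pi * Complex.I * j * k / d), conj a]

/-- The ordered product over `j = 0, 1, ..., d - 1` (ascending from left to right) of the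
twisted matrices with frequency `k`. -/
noncomputable def twistedProduct (d k : ℕ) (a b : Fin d → ℂ) : Matrix (Fin 2) (Fin 2) ℂ :=
  (List.ofFn fun j : Fin d => twistedMatrix d j k (a j) (b j)).prod

/-! The function is `β(t) = ε √(log (1 + (t/ε)²))` with `ε` small depending on `d`. Since `1 + |b|²
= |a|²`, it is comparable to `√(log |a|)`. The point of `ε` is a separation of scales: the strict
concavity of the logarithm is felt when the entries have size `ε`, the nonlinearity of the matrix
product only at size `1`, so the concavity gain can pay for the nonlinear error.

Let `b m` be the largest entry and `b l` the second largest. If `|b l|` is at least a large multiple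
of `ε`, the crude bound for the product already gives `log (1 + |B k|²/ε²) ≤ ∑ log (1 + |b j|²/ε²)`
for each `k` (`log_one_add_le_sum_of_two_large`), and subadditivity of powers finishes, for all
exponents at once.

Otherwise all entries but one are small, and `B k` is the discrete Fourier transform of a sequence
`e` close to `b` (`exists_fourier_coeff_twistedProduct`). With `ξ j = |b j|/ε` and `V = ∑ ξ j²`,
bound the logarithm by its tangent at `V`: this is affine in `|B k|²`, with slope `s = 1/(1+V)` and
constant term `V (h - s)`, where `h = log (1+V)/V`. Splitting the constant term as `∑ ξ j² (h - s)`
makes the affine function the squared norm of a Fourier transform of vectors, the `j`-th of which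
carries its own orthogonal component. Vector-valued Hausdorff–Young (`hausdorffYoung_augmented`)
then reduces everything to comparing `s |e j|²/ε² + ξ j² (h - s)` with `log (1 + ξ j²)`.

For `e = b` the former is `h ξ j²`, which is at most the latter because `log (1+v)/v` decreases. For
the true `e`, the quantitative decrease (`log_div_sub_log_div_ge`) gives a gain at `l` that absorbs
the errors (`sum_rpow_le_of_small`, `sum_rpow_le_of_large`). -/

/-! ### Vector-valued Hausdorff–Young by complex interpolation -/

/-- The exponential is an entire version of `x ^ (r (1 - z/2) - 1)`, the factor that rescales a
vector of norm `x` in the interpolation family. At `x = 0` it equals `1`, as `Real.log 0 = 0`, and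
positivity of the exponent makes both sides vanish. -/
lemma norm_cexp_log_mul_self {x r : ℝ} (hx : 0 ≤ x) {z : ℂ} (hr : 0 < r * (1 - z.re / 2)) :
    ‖Complex.exp (Real.log x * (r * (1 - z / 2) - 1))‖ * x = x ^ (r * (1 - z.re / 2)) := by
  rcases hx.eq_or_lt with rfl | hx
  · simp [Real.zero_rpow hr.ne']
  · have h : (Real.log x * (r * (1 - z / 2) - 1) : ℂ).re =
        Real.log x * (r * (1 - z.re / 2)) - Real.log x := by
      simp [Complex.mul_re]
      ring
    rw [Complex.norm_exp, h, Real.exp_sub, Real.exp_log hx, Real.rpow_def_of_pos hx]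
    field_simp

lemma norm_cexp_log_le {x r : ℝ} (hr : 0 ≤ r) {z : ℂ} (h0 : 0 ≤ z.re) (h1 : z.re ≤ 1) :
    ‖Complex.exp (Real.log x * (r * (1 - z / 2) - 1))‖ ≤ Real.exp (|Real.log x| * (r + 1)) := by
  have h : (Real.log x * (r * (1 - z / 2) - 1) : ℂ).re =
      Real.log x * (r * (1 - z.re / 2) - 1) := by
    simp [Complex.mul_re]
  rw [Complex.norm_exp, h, Real.exp_le_exp]
  refine (le_abs_self _).trans ?_
  rw [abs_mul]
  gcongr
  rw [abs_le]
  constructor <;> nlinarith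

/-- **Hausdorff–Young inequality** for a finite family of vectors in an inner product space,
interpolated between the trivial `ℓ¹ → ℓ^∞` bound and an `ℓ² → ℓ²` bound. -/
theorem hausdorffYoung_of_l2_bound {ι κ E : Type*} [Fintype ι] [Fintype κ]
    [NormedAddCommGroup E] [InnerProductSpace ℂ E] {T : κ → ι → ℂ} (hT : ∀ k j, ‖T k j‖ ≤ 1)
    {D : ℝ} (hD : 0 < D)
    (h2 : ∀ v : ι → E, ∑ k, ‖∑ j, T k j • v j‖ ^ 2 ≤ D * ∑ j, ‖v j‖ ^ 2)
    (v : ι → E) {p q : ℝ} (hpq : p.HolderConjugate q) (hp : p ≤ 2) :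
    ((1 / D) * ∑ k, ‖∑ j, T k j • v j‖ ^ q) ^ (1 / q) ≤ (∑ j, ‖v j‖ ^ p) ^ (1 / p) := by
  have hp0 := hpq.pos
  have hq0 := hpq.symm.pos
  have hp1 := hpq.lt
  have hpq1 : 1 / p + 1 / q = 1 := by simpa using hpq.inv_add_inv_eq_one
  set V : κ → E := fun k => ∑ j, T k j • v j with hV
  set X : ℝ := ∑ j, ‖v j‖ ^ p with hX
  set Y : ℝ := (1 / D) * ∑ k, ‖V k‖ ^ q with hY
  have hX0 : 0 ≤ X := Finset.sum_nonneg fun j _ => by positivity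
  have hYs : 0 ≤ ∑ k, ‖V k‖ ^ q := Finset.sum_nonneg fun j _ => by positivity
  have hY0 : 0 ≤ Y := by positivity
  let e : κ → ℂ → ℂ := fun k z => Complex.exp (Real.log ‖V k‖ * (q * (1 - z / 2) - 1))
  let u : ι → ℂ → ℂ := fun j z => Complex.exp (Real.log ‖v j‖ * (p * (1 - z / 2) - 1))
  -- The Riesz–Thorin pairing of the rescaled output with the transform of the rescaled input. The
  -- factor `e k z` stays outside the inner product, which is conjugate linear in its first slot, so
  -- that `f` is entire.
  let f : ℂ → ℂ := fun z => (1 / D : ℝ) * ∑ k, ∑ j, e k z * u j z * (T k j * inner ℂ (V k) (v j))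
  have hf : ∀ z, f z = (1 / D : ℝ) * ∑ k, e k z * inner ℂ (V k) (∑ j, T k j • (u j z • v j)) := by
    intro z
    simp only [f, inner_sum, inner_smul_right, Finset.mul_sum]
    refine Finset.sum_congr rfl fun k _ => Finset.sum_congr rfl fun j _ => ?_
    ring
  have hfn : ∀ z : ℂ, ‖f z‖ ≤ (1 / D) * ∑ k, (‖e k z‖ * ‖V k‖) * ‖∑ j, T k j • (u j z • v j)‖ := by
    intro z
    rw [hf, norm_mul, Complex.norm_real, Real.norm_of_nonneg (by positivity)]
    gcongr
    refine (norm_sum_le _ _).trans (Finset.sum_le_sum fun k _ => ?_)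
    rw [norm_mul, mul_assoc]
    gcongr
    exact norm_inner_le_norm _ _
  have hdiff : DiffContOnCl ℂ f (Complex.HadamardThreeLines.verticalStrip 0 1) := by
    apply Differentiable.diffContOnCl
    simp only [f, e, u]
    fun_prop
  have hbdd : BddAbove ((norm ∘ f) '' Complex.HadamardThreeLines.verticalClosedStrip 0 1) := by
    refine ⟨(1 / D) * ∑ k, ∑ j, Real.exp (|Real.log ‖V k‖| * (q + 1)) *
      Real.exp (|Real.log ‖v j‖| * (p + 1)) * ‖T k j * inner ℂ (V k) (v j)‖, ?_⟩
    rintro _ ⟨z, hz, rfl⟩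
    obtain ⟨hz0, hz1⟩ : 0 ≤ z.re ∧ z.re ≤ 1 := hz
    simp only [Function.comp, f]
    rw [norm_mul, Complex.norm_real, Real.norm_of_nonneg (by positivity)]
    gcongr
    refine (norm_sum_le _ _).trans (Finset.sum_le_sum fun k _ => ?_)
    refine (norm_sum_le _ _).trans (Finset.sum_le_sum fun j _ => ?_)
    rw [norm_mul, norm_mul]
    gcongr
    · exact norm_cexp_log_le hq0.le hz0 hz1
    · exact norm_cexp_log_le hp0.le hz0 hz1
  have hleft : ∀ z ∈ Complex.re ⁻¹' {(0 : ℝ)}, ‖f z‖ ≤ X * Y := by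
    intro z hz
    have hz : z.re = 0 := hz
    refine (hfn z).trans ?_
    have : X * Y = (1 / D) * ∑ k, ‖V k‖ ^ q * X := by rw [← Finset.sum_mul, hY]; ring
    rw [this]
    gcongr with k _
    · apply le_of_eq
      have := norm_cexp_log_mul_self (norm_nonneg (V k)) (r := q) (z := z) (by simp [hz, hq0])
      simpa [hz, e] using this
    · refine (norm_sum_le _ _).trans (Finset.sum_le_sum fun j _ => ?_)
      rw [norm_smul, norm_smul]
      have := norm_cexp_log_mul_self (norm_nonneg (v j)) (r := p) (z := z) (by simp [hz, hp0])
      simp only [hz, zero_div, sub_zero, mul_one] at this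
      rw [this]
      exact mul_le_of_le_one_left (by positivity) (hT k j)
  have hright : ∀ z ∈ Complex.re ⁻¹' {(1 : ℝ)}, ‖f z‖ ≤ √(X * Y) := by
    intro z hz
    have hz : z.re = 1 := hz
    have half : ∀ {x r : ℝ}, 0 ≤ x → (x ^ (r * (1 - z.re / 2))) ^ 2 = x ^ r := by
      intro x r hx
      rw [← Real.rpow_natCast, ← Real.rpow_mul hx, hz]
      congr 1
      push_cast
      ring
    refine (hfn z).trans ?_
    have hcs := Real.sum_mul_le_sqrt_mul_sqrt Finset.univ (fun k => ‖e k z‖ * ‖V k‖)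
      (fun k => ‖∑ j, T k j • (u j z • v j)‖)
    have h1 : ∑ k, (‖e k z‖ * ‖V k‖) ^ 2 = D * Y := by
      rw [hY, ← mul_assoc, mul_one_div_cancel hD.ne', one_mul]
      refine Finset.sum_congr rfl fun k _ => ?_
      rw [← half (norm_nonneg _),
        ← norm_cexp_log_mul_self (norm_nonneg (V k)) (r := q) (z := z) (by rw [hz]; linarith)]
    have h3 : ∑ k, ‖∑ j, T k j • (u j z • v j)‖ ^ 2 ≤ D * X := by
      refine (h2 _).trans_eq ?_
      congr 1
      refine Finset.sum_congr rfl fun j _ => ?_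
      rw [norm_smul, ← half (norm_nonneg _),
        ← norm_cexp_log_mul_self (norm_nonneg (v j)) (r := p) (z := z) (by rw [hz]; linarith)]
    calc _ ≤ (1 / D) * (√(D * Y) * √(D * X)) := by
          gcongr
          refine hcs.trans ?_
          rw [h1]
          gcongr
      _ = √(X * Y) := by
          rw [← Real.sqrt_mul (by positivity), show D * Y * (D * X) = D ^ 2 * (X * Y) by ring,
            Real.sqrt_mul (by positivity), Real.sqrt_sq hD.le]
          field_simp
  have hpinv : 1 / 2 ≤ 1 / p := one_div_le_one_div_of_le hp0 hp
  have hqinv : 0 < 1 / q := by positivity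
  -- At `z = 2/q`, in the strip because `q ≥ 2`, every `u j` is `1` and `e k` is `‖V k‖ ^ (q - 2)`
  -- when `V k ≠ 0`, so `f` takes the value `Y`. The edge bounds `X Y` and `√(X Y)` interpolate to
  -- `Y ≤ (X Y) ^ (1/p)`.
  have key := Complex.HadamardThreeLines.norm_le_interp_of_mem_verticalClosedStrip₀₁' f
    (z := ((2 / q : ℝ) : ℂ)) (a := X * Y) (b := √(X * Y))
    (by
      constructor
      · rw [Complex.ofReal_re]; positivity
      · rw [Complex.ofReal_re, show (2 / q : ℝ) = 2 * (1 / q) by ring]; linarith)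
    hdiff hbdd hleft hright
  have hval : f ((2 / q : ℝ) : ℂ) = (Y : ℂ) := by
    rw [hf, hY]
    push_cast
    congr 1
    refine Finset.sum_congr rfl fun k _ => ?_
    have hu : ∀ j, u j (2 / q) = 1 := by
      intro j
      have h : (p * (1 - 1 / q) : ℝ) = 1 := by
        rw [show 1 - 1 / q = 1 / p by linarith]
        field_simp
      have h' : (p * (1 - 2 / q / 2) - 1 : ℂ) = ((p * (1 - 1 / q) - 1 : ℝ) : ℂ) := by
        push_cast
        congr 3
        ring
      simp only [u]
      rw [h', h]
      simp
    simp only [hu, one_smul]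
    rw [show ∑ j, T k j • v j = V k from rfl, inner_self_eq_norm_sq_to_K]
    have h' : (q * (1 - 2 / q / 2) - 1 : ℂ) = ((q - 2 : ℝ) : ℂ) := by
      have : (q : ℂ) ≠ 0 := by exact_mod_cast hq0.ne'
      push_cast
      field_simp
      ring
    simp only [e]
    rw [h']
    rcases (norm_nonneg (V k)).eq_or_lt with h | h
    · rw [← h]; simp [Real.zero_rpow hq0.ne']
    · rw [Real.rpow_def_of_pos h, ← Complex.ofReal_mul,
        ← Complex.ofReal_exp]
      have : ‖V k‖ ^ 2 = Real.exp (Real.log ‖V k‖ * 2) := by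
        rw [← Real.rpow_def_of_pos h]; norm_num
      change _ * (‖V k‖ : ℂ) ^ 2 = _
      rw [← Complex.ofReal_pow, this, ← Complex.ofReal_mul, ← Real.exp_add]
      congr 2
      ring
  rw [hval, Complex.norm_real, Real.norm_of_nonneg hY0, Complex.ofReal_re, Real.sqrt_eq_rpow,
    ← Real.rpow_mul (by positivity)] at key
  rcases hY0.eq_or_lt with h | hYp
  · rw [← h, Real.zero_rpow (by positivity)]; positivity
  rcases hX0.eq_or_lt with h | hXp
  · rw [← h, zero_mul] at key
    have hk : (0 : ℝ) ^ (1 / 2 * (2 / q)) = 0 := Real.zero_rpow (by positivity)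
    rw [hk, mul_zero] at key
    linarith
  rw [← Real.rpow_add (by positivity),
    show 1 - 2 / q + 1 / 2 * (2 / q) = 1 / p by rw [show 1 / p = 1 - 1 / q by linarith]; ring,
    Real.mul_rpow hX0 hY0] at key
  have hsplit : Y = Y ^ (1 / q) * Y ^ (1 / p) := by
    rw [← Real.rpow_add hYp, add_comm, hpq1, Real.rpow_one]
  have hYpp : 0 < Y ^ (1 / p) := by positivity
  refine le_of_mul_le_mul_right ?_ hYpp
  rw [← hsplit]
  exact key

/-! ### Characters of the cyclic group and the Plancherel identity -/

/-- The character value `exp (2πijk/d)`. -/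
noncomputable def rootChar (d j k : ℕ) : ℂ :=
  Complex.exp (2 * Real.pi * Complex.I * j * k / d)

lemma rootChar_eq_exp_mul_I (d j k : ℕ) :
    rootChar d j k = Complex.exp ((2 * Real.pi * j * k / d : ℝ) * Complex.I) := by
  rw [rootChar]
  congr 1
  push_cast
  ring

lemma norm_rootChar (d j k : ℕ) : ‖rootChar d j k‖ = 1 := by
  rw [rootChar_eq_exp_mul_I, Complex.norm_exp_ofReal_mul_I]

lemma conj_rootChar (d j k : ℕ) :
    conj (rootChar d j k) = Complex.exp (-(2 * Real.pi * Complex.I * j * k / d)) := by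
  rw [rootChar_eq_exp_mul_I, ← Complex.exp_conj, map_mul, Complex.conj_ofReal, Complex.conj_I]
  congr 1
  push_cast
  ring

lemma rootChar_comm (d j k : ℕ) : rootChar d j k = rootChar d k j := by
  rw [rootChar, rootChar]
  congr 1
  ring

lemma rootChar_mul_conj_self (d j k : ℕ) : rootChar d j k * conj (rootChar d j k) = 1 := by
  rw [Complex.mul_conj, Complex.normSq_eq_norm_sq, norm_rootChar]
  simp

lemma sum_rootChar_mul_conj {d : ℕ} (hd : d ≠ 0) (i j : Fin d) :
    ∑ k : Fin d, rootChar d i k * conj (rootChar d j k) = if i = j then (d : ℂ) else 0 := by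
  have hd' : (d : ℂ) ≠ 0 := by exact_mod_cast hd
  split_ifs with h
  · subst h
    simp [rootChar_mul_conj_self]
  · have hprim := Complex.isPrimitiveRoot_exp d hd
    set ζ := Complex.exp (2 * Real.pi * Complex.I / d) with hζ
    have hζ0 : ζ ≠ 0 := Complex.exp_ne_zero _
    have hpow : ∀ a k : ℕ, rootChar d a k = (ζ ^ a) ^ k := by
      intro a k
      rw [rootChar, hζ, ← pow_mul, ← Complex.exp_nat_mul]
      congr 1
      push_cast
      ring
    have hconj : ∀ a k : ℕ, conj (rootChar d a k) = ((ζ ^ a)⁻¹) ^ k := by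
      intro a k
      rw [conj_rootChar, Complex.exp_neg, ← rootChar, hpow, inv_pow]
    set z := ζ ^ (i : ℕ) * (ζ ^ (j : ℕ))⁻¹ with hz
    have hterm : ∀ k : Fin d, rootChar d i k * conj (rootChar d j k) = z ^ (k : ℕ) := by
      intro k
      rw [hpow, hconj, hz, mul_pow]
    simp only [hterm]
    rw [Fin.sum_univ_eq_sum_range (fun k => z ^ k)]
    have hz1 : z ≠ 1 := by
      intro h1
      apply h
      rw [hz, mul_inv_eq_one₀ (pow_ne_zero _ hζ0)] at h1
      exact Fin.ext (hprim.pow_inj i.2 j.2 h1)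
    have hzd : z ^ d = 1 := by
      rw [hz, mul_pow, inv_pow, ← pow_mul, ← pow_mul, mul_comm (i : ℕ), mul_comm (j : ℕ), pow_mul,
        pow_mul, hprim.pow_eq_one]
      simp
    rw [geom_sum_eq hz1, hzd]
    simp

lemma sum_norm_sq_sum_rootChar_smul {E : Type*} [NormedAddCommGroup E] [InnerProductSpace ℂ E]
    {d : ℕ} (hd : d ≠ 0) (v : Fin d → E) :
    ∑ k : Fin d, ‖∑ j : Fin d, rootChar d j k • v j‖ ^ 2 = d * ∑ j, ‖v j‖ ^ 2 := by
  have hC : ∑ k : Fin d, ((‖∑ j : Fin d, rootChar d j k • v j‖ ^ 2 : ℝ) : ℂ) =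
      d * ∑ j, ((‖v j‖ ^ 2 : ℝ) : ℂ) := by
    have hn : ∀ w : E, ((‖w‖ ^ 2 : ℝ) : ℂ) = inner ℂ w w := fun w => by
      rw [inner_self_eq_norm_sq_to_K]; simp
    simp only [hn, inner_sum, sum_inner, inner_smul_left, inner_smul_right]
    rw [Finset.sum_comm]
    rw [Finset.mul_sum]
    refine Finset.sum_congr rfl fun i _ => ?_
    simp only [Finset.mul_sum]
    rw [Finset.sum_comm]
    rw [Finset.sum_eq_single i]
    · simp only [← mul_assoc]
      rw [← Finset.sum_mul, sum_rootChar_mul_conj hd]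
      simp
    · intro j _ hj
      simp only [← mul_assoc]
      rw [← Finset.sum_mul, sum_rootChar_mul_conj hd, if_neg (Ne.symm hj), zero_mul]
    · simp
  exact_mod_cast hC

/-- Every function on `Fin d` is a combination of the characters `rootChar d j`, with coefficients
bounded by its sup norm. -/
lemma exists_rootChar_coeff {d : ℕ} (hd : d ≠ 0) (R : Fin d → ℂ) {K : ℝ} (hR : ∀ k, ‖R k‖ ≤ K) :
    ∃ e : Fin d → ℂ, (∀ j, ‖e j‖ ≤ K) ∧ ∀ k : Fin d, R k = ∑ j : Fin d, rootChar d j k * e j := by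
  have hd' : (d : ℂ) ≠ 0 := by exact_mod_cast hd
  have hd0 : (0 : ℝ) < d := by exact_mod_cast Nat.pos_of_ne_zero hd
  refine ⟨fun j => (d : ℂ)⁻¹ * ∑ i : Fin d, R i * conj (rootChar d j i), fun j => ?_, fun k => ?_⟩
  · rw [norm_mul, norm_inv, Complex.norm_natCast, inv_mul_le_iff₀ hd0]
    refine (norm_sum_le _ _).trans ?_
    calc _ ≤ ∑ i : Fin d, K := Finset.sum_le_sum fun i _ => by
            rw [norm_mul, RCLike.norm_conj, norm_rootChar, mul_one]; exact hR i
      _ = _ := by simp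
  · have : ∑ j : Fin d, rootChar d j k * ((d : ℂ)⁻¹ * ∑ i : Fin d, R i * conj (rootChar d j i)) =
        (d : ℂ)⁻¹ * ∑ i : Fin d, R i * ∑ j : Fin d, rootChar d k j * conj (rootChar d i j) := by
      simp only [Finset.mul_sum]
      rw [Finset.sum_comm]
      refine Finset.sum_congr rfl fun i _ => Finset.sum_congr rfl fun j _ => ?_
      rw [rootChar_comm d k j, rootChar_comm d i j]
      ring
    rw [this]
    simp only [sum_rootChar_mul_conj hd]
    simp only [mul_ite, mul_zero, Finset.sum_ite_eq, Finset.mem_univ, if_true]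
    field_simp

/-- Hausdorff–Young on `Fin d` for a scalar sequence augmented by mutually orthogonal components
of squared lengths `D j`. -/
theorem hausdorffYoung_augmented {d : ℕ} (hd : d ≠ 0) (c : Fin d → ℂ) {s : ℝ} (hs : 0 ≤ s)
    {D : Fin d → ℝ} (hD : ∀ j, 0 ≤ D j) {p q : ℝ} (hpq : p.HolderConjugate q) (hp : p ≤ 2) :
    ((1 / (d : ℝ)) * ∑ k : Fin d,
        (s * ‖∑ j : Fin d, rootChar d j k * c j‖ ^ 2 + ∑ j, D j) ^ (q / 2)) ^ (1 / q) ≤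
      (∑ j, (s * ‖c j‖ ^ 2 + D j) ^ (p / 2)) ^ (1 / p) := by
  -- Coordinate `none` carries the scalar sequence. Coordinate `some j` is used by `v j` alone, so
  -- in each transform its modulus does not depend on `k` and the squares add up to `∑ D j`.
  let v : Fin d → EuclideanSpace ℂ (Option (Fin d)) := fun j =>
    WithLp.toLp 2 fun o => o.elim ((√s : ℝ) * c j) fun i => if i = j then ((√(D j) : ℝ) : ℂ) else 0
  have hd0 : (0 : ℝ) < d := by exact_mod_cast Nat.pos_of_ne_zero hd
  have key := hausdorffYoung_of_l2_bound (T := fun (k j : Fin d) => rootChar d j k)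
    (fun k j => (norm_rootChar d j k).le) hd0
    (fun w => (sum_norm_sq_sum_rootChar_smul hd w).le) v hpq hp
  have hpow : ∀ (w : EuclideanSpace ℂ (Option (Fin d))) (r : ℝ),
      ‖w‖ ^ r = (‖w‖ ^ 2) ^ (r / 2) := by
    intro w r
    rw [← Real.rpow_natCast, ← Real.rpow_mul (norm_nonneg _)]
    congr 1
    push_cast
    ring
  have hv : ∀ j, ‖v j‖ ^ 2 = s * ‖c j‖ ^ 2 + D j := by
    intro j
    rw [EuclideanSpace.norm_sq_eq, Fintype.sum_option]
    simp only [v, Option.elim, norm_mul, mul_pow, Complex.norm_real, Real.norm_eq_abs, sq_abs,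
      Real.sq_sqrt hs]
    rw [Finset.sum_eq_single j]
    · simp [Real.sq_sqrt (hD j)]
    · intro i _ hi
      simp [hi]
    · simp
  have hV : ∀ k : Fin d, ‖∑ j : Fin d, rootChar d j k • v j‖ ^ 2 =
      s * ‖∑ j : Fin d, rootChar d j k * c j‖ ^ 2 + ∑ j, D j := by
    intro k
    rw [EuclideanSpace.norm_sq_eq, Fintype.sum_option]
    simp only [WithLp.ofLp_sum, WithLp.ofLp_smul, Finset.sum_apply, Pi.smul_apply, smul_eq_mul, v,
      Option.elim]
    congr 1
    · have : ∑ j : Fin d, rootChar d j k * ((√s : ℝ) * c j) =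
          (√s : ℝ) * ∑ j : Fin d, rootChar d j k * c j := by
        rw [Finset.mul_sum]
        exact Finset.sum_congr rfl fun j _ => by ring
      rw [this, norm_mul, mul_pow, Complex.norm_real, Real.norm_eq_abs, sq_abs, Real.sq_sqrt hs]
    · refine Finset.sum_congr rfl fun i _ => ?_
      simp [norm_rootChar, Real.sq_sqrt (hD i)]
  simp only [hpow, hv, hV] at key
  exact key

/-! ### Products in `SU(1,1)` and their linear part -/

lemma su11Matrix_mul (a b a' b' : ℂ) :
    su11Matrix a b * su11Matrix a' b' =
      su11Matrix (a * a' + conj b * b') (b * a' + conj a * b') := by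
  ext i j
  fin_cases i <;> fin_cases j <;> simp [su11Matrix, Matrix.mul_apply, Fin.sum_univ_two] <;> ring

lemma su11Matrix_one_zero : su11Matrix 1 0 = 1 := by
  ext i j
  fin_cases i <;> fin_cases j <;> simp [su11Matrix]

lemma su11Matrix_inj {a b a' b' : ℂ} (h : su11Matrix a b = su11Matrix a' b') : a = a' ∧ b = b' := by
  constructor
  · simpa [su11Matrix] using congrFun (congrFun h 0) 0
  · simpa [su11Matrix] using congrFun (congrFun h 1) 0

lemma norm_sq_sub_of_mem_SU11 {a b : ℂ} (h : su11Matrix a b ∈ SU11) : ‖a‖ ^ 2 - ‖b‖ ^ 2 = 1 := by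
  obtain ⟨a', b', h1, h2⟩ := h
  obtain ⟨rfl, rfl⟩ := su11Matrix_inj h2
  exact h1

lemma twistedMatrix_eq_su11Matrix (d j k : ℕ) (a b : ℂ) :
    twistedMatrix d j k a b = su11Matrix a (rootChar d j k * b) := by
  rw [twistedMatrix, su11Matrix, map_mul, conj_rootChar, rootChar, mul_comm b, mul_comm (conj b)]

/-- An ordered product of matrices `su11Matrix (a j) (w j)` with `‖a j‖ = cosh (t j)` and
`‖w j‖ = sinh (t j)` is dominated by its hyperbolic counterpart, also after removing the part of
degree at most one in `w`. -/
theorem prod_su11Matrix_linear_part : ∀ {n : ℕ} (a : Fin n → ℂ) (t : Fin n → ℝ),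
    (∀ j, ‖a j‖ = Real.cosh (t j)) →
    ∃ α : Fin n → ℂ, (∀ j, ‖α j‖ = (∏ i, Real.cosh (t i)) / Real.cosh (t j)) ∧
      ∀ w : Fin n → ℂ, (∀ j, ‖w j‖ = Real.sinh (t j)) →
        ∃ U W : ℂ, (List.ofFn fun j => su11Matrix (a j) (w j)).prod = su11Matrix U W ∧
          ‖U‖ ≤ Real.cosh (∑ j, t j) ∧ ‖W‖ ≤ Real.sinh (∑ j, t j) ∧
          ‖U - ∏ j, a j‖ ≤ Real.cosh (∑ j, t j) - ∏ j, Real.cosh (t j) ∧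
          ‖W - ∑ j, α j * w j‖ ≤ Real.sinh (∑ j, t j) -
            ∑ j, Real.sinh (t j) * ((∏ i, Real.cosh (t i)) / Real.cosh (t j)) := by
  intro n
  induction n with
  | zero =>
    intro a t _
    refine ⟨fun _ => 0, fun j => j.elim0, fun w _ => ⟨1, 0, ?_, ?_⟩⟩
    · simp [su11Matrix_one_zero]
    · simp
  | succ n ih =>
    intro a t ha
    obtain ⟨α, hα, hprods⟩ := ih (fun j => a j.succ) (fun j => t j.succ) (fun j => ha j.succ)
    have hc : ∀ x, Real.cosh x ≠ 0 := fun x => (Real.cosh_pos x).ne'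
    -- Unrolled, `α j` is the product of the conjugates of `a i` for `i < j` and of `a i` for `i >
    -- j`. It does not involve `w`, so one `α` serves all frequencies of a twisted product.
    refine ⟨Fin.cons (∏ j : Fin n, a j.succ) fun j => conj (a 0) * α j, ?_, ?_⟩
    · intro j
      refine Fin.cases ?_ (fun j => ?_) j
      · rw [Fin.cons_zero, Fin.prod_univ_succ, norm_prod, mul_div_cancel_left₀ _ (hc _)]
        exact Finset.prod_congr rfl fun j _ => ha _
      · rw [Fin.cons_succ, norm_mul, RCLike.norm_conj, hα, ha, Fin.prod_univ_succ, mul_div_assoc]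
    · intro w hw
      obtain ⟨U, W, hprod, hU, hW, hUP, hWL⟩ := hprods (fun j => w j.succ) (fun j => hw j.succ)
      set τ := ∑ j : Fin n, t j.succ with hτ
      set P := ∏ j : Fin n, Real.cosh (t j.succ) with hP
      have hs0 : 0 ≤ Real.sinh (t 0) := hw 0 ▸ norm_nonneg _
      have hc0 := (Real.cosh_pos (t 0)).le
      refine ⟨a 0 * U + conj (w 0) * W, w 0 * U + conj (a 0) * W, ?_, ?_, ?_, ?_, ?_⟩
      · rw [List.ofFn_succ, List.prod_cons, hprod, su11Matrix_mul]
      · rw [Fin.sum_univ_succ, Real.cosh_add]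
        refine (norm_add_le _ _).trans ?_
        rw [norm_mul, norm_mul, RCLike.norm_conj, ha, hw]
        gcongr
      · rw [Fin.sum_univ_succ, Real.sinh_add]
        refine (norm_add_le _ _).trans ?_
        rw [norm_mul, norm_mul, RCLike.norm_conj, ha, hw]
        gcongr
      · rw [Fin.sum_univ_succ, Real.cosh_add, Fin.prod_univ_succ, Fin.prod_univ_succ,
          show a 0 * U + conj (w 0) * W - a 0 * ∏ j : Fin n, a j.succ =
            a 0 * (U - ∏ j : Fin n, a j.succ) + conj (w 0) * W by ring]
        refine (norm_add_le _ _).trans ?_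
        rw [norm_mul, norm_mul, RCLike.norm_conj, ha, hw]
        nlinarith [mul_le_mul_of_nonneg_left hUP hc0, mul_le_mul_of_nonneg_left hW hs0]
      · rw [Fin.sum_univ_succ, Fin.sum_univ_succ, Fin.sum_univ_succ, Real.sinh_add,
          Fin.prod_univ_succ, mul_div_cancel_left₀ _ (hc _)]
        simp only [Fin.cons_zero, Fin.cons_succ]
        have h1 : ∑ j : Fin n, conj (a 0) * α j * w j.succ =
            conj (a 0) * ∑ j : Fin n, α j * w j.succ := by
          rw [Finset.mul_sum]
          exact Finset.sum_congr rfl fun j _ => by ring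
        have h2 : ∑ j : Fin n, Real.sinh (t j.succ) *
              (Real.cosh (t 0) * P / Real.cosh (t j.succ)) =
            Real.cosh (t 0) * ∑ j : Fin n, Real.sinh (t j.succ) *
              (P / Real.cosh (t j.succ)) := by
          rw [Finset.mul_sum]
          exact Finset.sum_congr rfl fun j _ => by ring
        rw [h1, h2, show w 0 * U + conj (a 0) * W - ((∏ j : Fin n, a j.succ) * w 0 +
            conj (a 0) * ∑ j : Fin n, α j * w j.succ) = w 0 * (U - ∏ j : Fin n, a j.succ) +
            conj (a 0) * (W - ∑ j : Fin n, α j * w j.succ) by ring]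
        refine (norm_add_le _ _).trans ?_
        rw [norm_mul, norm_mul, RCLike.norm_conj, ha, hw]
        nlinarith [mul_le_mul_of_nonneg_left hUP hs0, mul_le_mul_of_nonneg_left hWL hc0]

/-! ### Estimates for hyperbolic functions -/

lemma self_le_sinh {x : ℝ} (hx : 0 ≤ x) : x ≤ Real.sinh x := Real.self_le_sinh_iff.2 hx

lemma sinh_le_mul_cosh {x : ℝ} (hx : 0 ≤ x) : Real.sinh x ≤ x * Real.cosh x := by
  have hmono : MonotoneOn (fun y => y * Real.cosh y - Real.sinh y) (Set.Ici 0) := by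
    apply monotoneOn_of_deriv_nonneg (convex_Ici 0)
    · fun_prop
    · exact Differentiable.differentiableOn (by fun_prop)
    · intro y hy
      rw [interior_Ici] at hy
      have hy : 0 < y := hy
      have hder : HasDerivAt (fun y => y * Real.cosh y - Real.sinh y)
          (1 * Real.cosh y + y * Real.sinh y - Real.cosh y) y :=
        ((hasDerivAt_id y).mul (Real.hasDerivAt_cosh y)).sub (Real.hasDerivAt_sinh y)
      rw [hder.deriv]
      have := mul_nonneg hy.le (Real.sinh_nonneg_iff.2 hy.le)
      linarith
  have := hmono (Set.self_mem_Ici) (Set.mem_Ici.2 hx) hx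
  simp at this
  linarith

lemma cosh_sub_one_le_sq {x : ℝ} (h0 : 0 ≤ x) (h1 : x ≤ 1) : Real.cosh x - 1 ≤ x ^ 2 := by
  have h := Real.cosh_le_exp_half_sq x
  have hx : x ^ 2 ≤ 1 := by nlinarith
  have h2 := Real.abs_exp_sub_one_sub_id_le (x := x ^ 2 / 2)
    (by rw [abs_of_nonneg (by positivity)]; linarith)
  have h3 := (abs_le.1 h2).2
  nlinarith [sq_nonneg x]

lemma sinh_sub_self_le_cube {x : ℝ} (h0 : 0 ≤ x) (h1 : x ≤ 1) : Real.sinh x - x ≤ x * x ^ 2 := by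
  nlinarith [sinh_le_mul_cosh h0, mul_le_mul_of_nonneg_left (cosh_sub_one_le_sq h0 h1) h0]

/-- The part of degree at least three of `sinh (∑ t)` is small when all but one of the `t j` are. -/
lemma sinh_sum_sub_linear_le {n : ℕ} {t : Fin n → ℝ} (ht : ∀ j, 0 ≤ t j) (m : Fin n) :
    Real.sinh (∑ j, t j) - ∑ j, Real.sinh (t j) * ((∏ i, Real.cosh (t i)) / Real.cosh (t j)) ≤
      Real.sinh (t m) * (Real.cosh (∑ j ∈ Finset.univ.erase m, t j) - 1) +
        Real.cosh (t m) * (Real.sinh (∑ j ∈ Finset.univ.erase m, t j) -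
          ∑ j ∈ Finset.univ.erase m, t j) := by
  have hc : ∀ x, Real.cosh x ≠ 0 := fun x => (Real.cosh_pos x).ne'
  set s := Finset.univ.erase m with hs
  have hprod : ∏ i, Real.cosh (t i) = Real.cosh (t m) * ∏ i ∈ s, Real.cosh (t i) :=
    (Finset.mul_prod_erase _ _ (Finset.mem_univ m)).symm
  have hP1 : 1 ≤ ∏ i ∈ s, Real.cosh (t i) :=
    calc (1 : ℝ) = ∏ i ∈ s, 1 := by simp
      _ ≤ _ := Finset.prod_le_prod (by simp) fun i _ => Real.one_le_cosh _
  have hPj : ∀ j ∈ s, Real.cosh (t j) ≤ ∏ i ∈ s, Real.cosh (t i) := by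
    intro j hj
    rw [← Finset.mul_prod_erase _ _ hj]
    refine le_mul_of_one_le_right (Real.cosh_pos _).le ?_
    calc (1 : ℝ) = ∏ i ∈ s.erase j, 1 := by simp
        _ ≤ _ := Finset.prod_le_prod (by simp) fun i _ => Real.one_le_cosh _
  rw [← Finset.add_sum_erase _ t (Finset.mem_univ m),
    ← Finset.add_sum_erase _ (fun j => Real.sinh (t j) * _) (Finset.mem_univ m), Real.sinh_add,
    hprod, mul_div_cancel_left₀ _ (hc _), ← hs]
  have hsum : Real.cosh (t m) * ∑ j ∈ s, t j ≤ ∑ j ∈ s, Real.sinh (t j) *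
      (Real.cosh (t m) * (∏ i ∈ s, Real.cosh (t i)) / Real.cosh (t j)) := by
    rw [Finset.mul_sum]
    refine Finset.sum_le_sum fun j hj => ?_
    have h1 : 1 ≤ (∏ i ∈ s, Real.cosh (t i)) / Real.cosh (t j) :=
      (one_le_div (Real.cosh_pos _)).2 (hPj j hj)
    have h2 := self_le_sinh (ht j)
    have h3 := (Real.cosh_pos (t m)).le
    calc Real.cosh (t m) * t j ≤ Real.cosh (t m) * Real.sinh (t j) * 1 := by
          rw [mul_one]; gcongr
      _ ≤ Real.cosh (t m) * Real.sinh (t j) *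
          ((∏ i ∈ s, Real.cosh (t i)) / Real.cosh (t j)) := by
          have := (ht j).trans h2
          gcongr
      _ = _ := by ring
  have h4 := mul_le_mul_of_nonneg_left hP1 (Real.sinh_nonneg_iff.2 (ht m))
  nlinarith

/-- Adding `t ≤ X` to the argument costs at most a factor `2 cosh t`: in `sinh X cosh t + cosh X
sinh t` the second term is at most the first, since `sinh (X - t) ≥ 0`. Starting from the largest
length `T` keeps `t ≤ X` at every stage. -/
lemma sinh_add_sum_le {ι : Type*} (s : Finset ι) {t : ι → ℝ} {T : ℝ}
    (ht : ∀ j ∈ s, 0 ≤ t j ∧ t j ≤ T) :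
    Real.sinh (T + ∑ j ∈ s, t j) ≤ 2 ^ s.card * (Real.sinh T * ∏ j ∈ s, Real.cosh (t j)) := by
  classical
  induction s using Finset.induction_on with
  | empty => simp
  | insert i s hi ih =>
    have hts : ∀ j ∈ s, 0 ≤ t j ∧ t j ≤ T := fun j hj => ht j (Finset.mem_insert_of_mem hj)
    have hti := ht i (Finset.mem_insert_self i s)
    have ih := ih hts
    have hS : 0 ≤ ∑ j ∈ s, t j := Finset.sum_nonneg fun j hj => (hts j hj).1
    rw [Finset.sum_insert hi, Finset.prod_insert hi, Finset.card_insert_of_notMem hi,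
      show T + (t i + ∑ j ∈ s, t j) = (T + ∑ j ∈ s, t j) + t i by ring, Real.sinh_add, pow_succ]
    set X := T + ∑ j ∈ s, t j
    have h1 : 0 ≤ Real.sinh (X - t i) := Real.sinh_nonneg_iff.2 (by linarith)
    rw [Real.sinh_sub] at h1
    nlinarith [mul_le_mul_of_nonneg_right ih (Real.cosh_pos (t i)).le]

lemma one_add_pow_le_of_le_one {y : ℝ} (h0 : 0 ≤ y) (h1 : y ≤ 1) (n : ℕ) :
    (1 + y) ^ n ≤ 1 + 2 ^ n * y := by
  -- The chord of the convex function `(1 + y) ^ n` over `[0, 1]`; this sharper form is the one that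
  -- passes through the induction.
  suffices h : (1 + y) ^ n ≤ 1 + (2 ^ n - 1) * y by nlinarith
  induction n with
  | zero => simp
  | succ n ih =>
    have h2 : (1 : ℝ) ≤ 2 ^ n := one_le_pow₀ (by norm_num)
    rw [pow_succ, pow_succ]
    nlinarith [mul_le_mul_of_nonneg_right ih (by linarith : (0 : ℝ) ≤ 1 + y),
      mul_le_mul_of_nonneg_left h1 (mul_nonneg (by linarith : (0 : ℝ) ≤ 2 ^ n - 1) h0)]

/-! ### Fourier coefficients of a twisted product -/

lemma norm_eq_cosh_arsinh_of_mem_SU11 {a b : ℂ} (h : su11Matrix a b ∈ SU11) :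
    ‖a‖ = Real.cosh (Real.arsinh ‖b‖) := by
  rw [Real.cosh_arsinh, eq_comm, Real.sqrt_eq_iff_mul_self_eq (by positivity) (by positivity)]
  linarith [norm_sq_sub_of_mem_SU11 h, sq ‖a‖]

/-- The lower left entry of a twisted product is at most `sinh` of the total hyperbolic length. -/
lemma norm_le_sinh_sum_arsinh {d : ℕ} {a b A B : Fin d → ℂ}
    (hab : ∀ j, su11Matrix (a j) (b j) ∈ SU11)
    (hprod : ∀ k : Fin d, su11Matrix (A k) (B k) = twistedProduct d k a b) (k : Fin d) :
    ‖B k‖ ≤ Real.sinh (∑ j, Real.arsinh ‖b j‖) := by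
  obtain ⟨α, -, h⟩ := prod_su11Matrix_linear_part a (fun j => Real.arsinh ‖b j‖)
    (fun j => norm_eq_cosh_arsinh_of_mem_SU11 (hab j))
  obtain ⟨U, W, h1, -, h2, -⟩ := h (fun j => rootChar d j k * b j)
    (fun j => by rw [norm_mul, norm_rootChar, one_mul, Real.sinh_arsinh])
  have hk := hprod k
  simp only [twistedProduct, twistedMatrix_eq_su11Matrix] at hk
  rw [h1] at hk
  rw [(su11Matrix_inj hk).2]
  exact h2

/-- The Fourier coefficients of the lower left entries of a twisted product, when all but one of
the `b j` are small, are close to the `b j`. -/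
theorem exists_fourier_coeff_twistedProduct {d : ℕ} {a b A B : Fin d → ℂ} (hd : d ≠ 0)
    (hab : ∀ j, su11Matrix (a j) (b j) ∈ SU11)
    (hprod : ∀ k : Fin d, su11Matrix (A k) (B k) = twistedProduct d k a b)
    {m : Fin d} {ρ : ℝ} (hρ0 : 0 ≤ ρ) (hρ1 : d * ρ ≤ 1) (hρm : ρ ≤ ‖b m‖)
    (hρ : ∀ j, j ≠ m → ‖b j‖ ≤ ρ) {C : ℝ} (hC : C = 1 + 2 * 2 ^ d + (2 * d + 1) * d ^ 2) :
    ∃ c : Fin d → ℂ, (∀ k : Fin d, B k = ∑ j : Fin d, rootChar d j k * c j) ∧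
      ‖c m‖ ≤ ‖b m‖ * (1 + C * ρ ^ 2) ∧
      (∀ j, j ≠ m → ‖c j‖ ≤ C * (√(1 + ‖b m‖ ^ 2) * ρ)) ∧
      (‖b m‖ ≤ 1 → ∀ j, j ≠ m → ‖c j‖ ≤ ‖b j‖ + C * ‖b m‖ ^ 2 * ρ) := by
  set t : Fin d → ℝ := fun j => Real.arsinh ‖b j‖ with ht
  set M := ‖b m‖ with hM
  have ht0 : ∀ j, 0 ≤ t j := fun j => Real.arsinh_nonneg_iff.2 (norm_nonneg _)
  have hsinh : ∀ j, Real.sinh (t j) = ‖b j‖ := fun j => Real.sinh_arsinh _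
  have hcosh : ∀ j, Real.cosh (t j) = √(1 + ‖b j‖ ^ 2) := fun j => Real.cosh_arsinh _
  have htb : ∀ j, t j ≤ ‖b j‖ := fun j => (self_le_sinh (ht0 j)).trans_eq (hsinh j)
  have hM0 : 0 ≤ M := norm_nonneg _
  have hd1 : (1 : ℝ) ≤ d := by exact_mod_cast Nat.one_le_iff_ne_zero.2 hd
  have hρ1' : ρ ≤ 1 := by nlinarith
  obtain ⟨α, hα, h⟩ := prod_su11Matrix_linear_part a t
    (fun j => norm_eq_cosh_arsinh_of_mem_SU11 (hab j))
  set s := Finset.univ.erase m with hs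
  have hcard : (s.card : ℝ) ≤ d := by
    have : s.card ≤ d := (Finset.card_le_univ s).trans_eq (Fintype.card_fin d)
    exact_mod_cast this
  have hcosh_le : ∀ j ∈ s, Real.cosh (t j) ≤ 1 + ρ ^ 2 := by
    intro j hj
    have hjρ := hρ j (Finset.ne_of_mem_erase hj)
    rw [hcosh, Real.sqrt_le_left (by positivity)]
    nlinarith [norm_nonneg (b j), sq_nonneg (ρ ^ 2)]
  set σ := ∑ j ∈ s, t j with hσ
  have hσ0 : 0 ≤ σ := Finset.sum_nonneg fun j _ => ht0 j
  have hσd : σ ≤ d * ρ := by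
    calc σ ≤ ∑ j ∈ s, ρ :=
          Finset.sum_le_sum fun j hj => (htb j).trans (hρ j (Finset.ne_of_mem_erase hj))
      _ = s.card * ρ := by simp
      _ ≤ d * ρ := by gcongr
  have hσ1 : σ ≤ 1 := hσd.trans hρ1
  -- `cosh (t m)` is not controlled by `M` when `M` is small. But `t j ≤ t m` gives `cosh (t m) sinh
  -- (t j) ≤ sinh (t m) cosh (t j)`, which trades it for `M`.
  have hσM : Real.cosh (t m) * σ ≤ 2 * d * M := by
    calc Real.cosh (t m) * σ ≤ ∑ j ∈ s, 2 * M := by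
          rw [hσ, Finset.mul_sum]
          refine Finset.sum_le_sum fun j hj => ?_
          have hjρ := hρ j (Finset.ne_of_mem_erase hj)
          have h1 : 0 ≤ Real.sinh (t m - t j) := Real.sinh_nonneg_iff.2
            (sub_nonneg.2 (Real.arsinh_le_arsinh.2 (hjρ.trans hρm)))
          rw [Real.sinh_sub, hsinh m, hsinh j] at h1
          have h2 : Real.cosh (t j) ≤ 2 := (hcosh_le j hj).trans (by linarith [pow_le_one₀ hρ0 hρ1' (n := 2)])
          calc Real.cosh (t m) * t j ≤ Real.cosh (t m) * ‖b j‖ := by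
                gcongr
                exact htb j
            _ ≤ M * Real.cosh (t j) := by linarith
            _ ≤ M * 2 := by gcongr
            _ = 2 * M := by ring
      _ = s.card * (2 * M) := by simp
      _ ≤ d * (2 * M) := by gcongr
      _ = _ := by ring
  set K : ℝ := (2 * d + 1) * d ^ 2 with hK
  -- Each term of degree at least three contains at least two small entries, whence the factor `ρ ^
  -- 2`.
  have hrem : Real.sinh (∑ j, t j) -
      ∑ j, Real.sinh (t j) * ((∏ i, Real.cosh (t i)) / Real.cosh (t j)) ≤ K * (M * ρ ^ 2) := by
    refine (sinh_sum_sub_linear_le ht0 m).trans ?_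
    rw [← hs, ← hσ, hsinh m]
    have h1 := mul_le_mul_of_nonneg_left (cosh_sub_one_le_sq hσ0 hσ1) hM0
    have h2 := mul_le_mul_of_nonneg_left (sinh_sub_self_le_cube hσ0 hσ1) (Real.cosh_pos (t m)).le
    have h3 := mul_le_mul_of_nonneg_right hσM (sq_nonneg σ)
    have h4 : σ ^ 2 ≤ (d * ρ) ^ 2 := by gcongr
    have h5 := mul_le_mul_of_nonneg_left h4 (by positivity : 0 ≤ (2 * d + 1) * M)
    rw [hK]
    linear_combination h1 + h2 + h3 + h5
  have hPs : ∏ i ∈ s, Real.cosh (t i) ≤ 1 + 2 ^ d * ρ ^ 2 := by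
    calc ∏ i ∈ s, Real.cosh (t i) ≤ ∏ i ∈ s, (1 + ρ ^ 2) :=
          Finset.prod_le_prod (fun i _ => (Real.cosh_pos _).le) hcosh_le
      _ = (1 + ρ ^ 2) ^ s.card := by simp
      _ ≤ (1 + ρ ^ 2) ^ d :=
          pow_le_pow_right₀ (le_add_of_nonneg_right (sq_nonneg ρ)) (by exact_mod_cast hcard)
      _ ≤ _ := one_add_pow_le_of_le_one (by positivity) (pow_le_one₀ hρ0 hρ1') d
  have hP : ∏ i, Real.cosh (t i) = Real.cosh (t m) * ∏ i ∈ s, Real.cosh (t i) :=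
    (Finset.mul_prod_erase _ _ (Finset.mem_univ m)).symm
  -- The coefficient at `m` omits the only possibly large factor `cosh (t m)`; the other
  -- coefficients contain it.
  have hαm : ‖α m‖ ≤ 1 + 2 ^ d * ρ ^ 2 := by
    rw [hα, hP, mul_div_cancel_left₀ _ (Real.cosh_pos _).ne']
    exact hPs
  have hαj : ∀ j, ‖α j‖ ≤ √(1 + M ^ 2) * (1 + 2 ^ d * ρ ^ 2) := by
    intro j
    rw [hα, hP, hcosh m]
    refine (div_le_self ?_ (Real.one_le_cosh _)).trans ?_
    · exact mul_nonneg (by positivity) (Finset.prod_nonneg fun i _ => (Real.cosh_pos _).le)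
    · gcongr
  -- The nonlinear remainder is an arbitrary function of `k`. Its inverse Fourier transform, bounded
  -- by the same constant, is added to the linear coefficients.
  obtain ⟨e, he, hR⟩ := exists_rootChar_coeff hd
    (fun k : Fin d => B k - ∑ j : Fin d, α j * (rootChar d j k * b j)) (K := K * (M * ρ ^ 2)) (by
      intro k
      obtain ⟨U, W, h1, -, -, -, h2⟩ := h (fun j => rootChar d j k * b j)
        (fun j => by rw [norm_mul, norm_rootChar, one_mul, Real.sinh_arsinh])
      have hk := hprod k
      simp only [twistedProduct, twistedMatrix_eq_su11Matrix] at hk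
      rw [h1] at hk
      rw [(su11Matrix_inj hk).2]
      exact h2.trans hrem)
  have hcn : ∀ j, ‖α j * b j + e j‖ ≤ ‖α j‖ * ‖b j‖ + K * (M * ρ ^ 2) := fun j =>
    (norm_add_le _ _).trans (by rw [norm_mul]; gcongr; exact he j)
  have hK0 : 0 ≤ K := by positivity
  have h2d : (0 : ℝ) ≤ 2 ^ d := by positivity
  refine ⟨fun j => α j * b j + e j, fun k => ?_, ?_, ?_, ?_⟩
  · have h1 := hR k
    have h2 : ∑ j : Fin d, rootChar d j k * (α j * b j + e j) =
        ∑ j : Fin d, α j * (rootChar d j k * b j) + ∑ j : Fin d, rootChar d j k * e j := by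
      rw [← Finset.sum_add_distrib]
      exact Finset.sum_congr rfl fun j _ => by ring
    rw [h2, ← h1]
    ring
  · refine (hcn m).trans ?_
    rw [← hM, hC]
    have h1 := mul_le_mul_of_nonneg_right hαm hM0
    have h2 : 0 ≤ (1 + 2 ^ d) * (M * ρ ^ 2) := by positivity
    linear_combination h1 + h2
  · intro j hj
    refine (hcn j).trans ?_
    have hsq : M ≤ √(1 + M ^ 2) := Real.le_sqrt_of_sq_le (by linarith)
    set r := √(1 + M ^ 2) with hr
    have h0 : 0 ≤ r := hM0.trans hsq
    have hρ2 : ρ ^ 2 ≤ ρ := pow_le_of_le_one hρ0 hρ1' two_ne_zero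
    have hρ3 : ρ ^ 2 ≤ 1 := hρ2.trans hρ1'
    have h1 : ‖α j‖ * ‖b j‖ ≤ (r * (1 + 2 ^ d * ρ ^ 2)) * ρ := by
      gcongr
      · exact hαj j
      · exact hρ j hj
    have h2 : M * ρ ^ 2 ≤ r * ρ := by gcongr
    have h3 : r * (1 + 2 ^ d * ρ ^ 2) * ρ ≤ r * (1 + 2 ^ d * 1) * ρ := by
      gcongr
    have h4 : 0 ≤ 2 ^ d * (r * ρ) := by positivity
    have h5 := mul_le_mul_of_nonneg_left h2 hK0
    rw [hC]
    linear_combination h1 + h3 + h4 + h5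
  · intro hM1 j hj
    refine (hcn j).trans ?_
    have hr : √(1 + M ^ 2) ≤ 1 + M ^ 2 := by
      rw [Real.sqrt_le_left (by positivity)]
      nlinarith [sq_nonneg (M ^ 2)]
    have hρM2 : ρ ^ 2 ≤ M ^ 2 := by gcongr
    have hM2 : M ^ 2 ≤ 1 := pow_le_one₀ hM0 hM1
    have h1 : ‖α j‖ ≤ 1 + (1 + 2 * 2 ^ d) * M ^ 2 := by
      calc ‖α j‖ ≤ _ := hαj j
        _ ≤ (1 + M ^ 2) * (1 + 2 ^ d * M ^ 2) := by gcongr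
        _ ≤ _ := by
          linear_combination mul_le_mul_of_nonneg_left hM2 (by positivity : 0 ≤ 2 ^ d * M ^ 2)
    have h2 : ‖α j‖ * ‖b j‖ ≤ ‖b j‖ + (1 + 2 * 2 ^ d) * M ^ 2 * ρ := by
      calc ‖α j‖ * ‖b j‖ ≤ (1 + (1 + 2 * 2 ^ d) * M ^ 2) * ‖b j‖ := by gcongr
        _ = ‖b j‖ + (1 + 2 * 2 ^ d) * M ^ 2 * ‖b j‖ := by ring
        _ ≤ _ := by
          gcongr
          exact hρ j hj
    have h3 : M * ρ ^ 2 ≤ M ^ 2 * ρ := by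
      linarith [mul_le_mul_of_nonneg_left hρm (mul_nonneg hM0 hρ0),
        show M * ρ * ρ = M * ρ ^ 2 by ring, show M * ρ * M = M ^ 2 * ρ by ring]
    have h4 := mul_le_mul_of_nonneg_left h3 hK0
    rw [hC]
    linear_combination h2 + h4

/-! ### Quantitative concavity of the logarithm -/

lemma log_one_add_le_tangent {u V : ℝ} (hu : 0 ≤ u) (hV : 0 ≤ V) :
    Real.log (1 + u) ≤ Real.log (1 + V) + (u - V) / (1 + V) := by
  have h := Real.log_le_sub_one_of_pos (x := (1 + u) / (1 + V)) (by positivity)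
  rw [Real.log_div (by positivity) (by positivity)] at h
  have : (1 + u) / (1 + V) - 1 = (u - V) / (1 + V) := by field_simp; ring
  linarith

lemma inv_one_add_le_log_div {V : ℝ} (hV : 0 < V) : 1 / (1 + V) ≤ Real.log (1 + V) / V := by
  have h := log_one_add_le_tangent le_rfl hV.le
  rw [add_zero, Real.log_one] at h
  rw [le_div_iff₀ hV]
  have : (0 - V) / (1 + V) = -(1 / (1 + V) * V) := by ring
  linarith

lemma log_one_add_div_le_one {V : ℝ} (hV : 0 < V) : Real.log (1 + V) / V ≤ 1 := by
  rw [div_le_one hV]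
  have := log_one_add_le_tangent hV.le le_rfl
  simpa using this

/-- The slope `log (1 + v) / v` decreases at least as fast as `1 / (2 * (1 + v))`. -/
lemma log_div_sub_log_div_ge {v V : ℝ} (hv : 0 < v) (hvV : v ≤ V) :
    (V - v) / (2 * (1 + v) * (1 + V)) ≤ Real.log (1 + v) / v - Real.log (1 + V) / V := by
  -- After division by `y ^ 2` this compares the derivatives of `log (1 + y) / y` and `1 / (2 * (1 +
  -- y))`. The difference of the two sides vanishes at `0` and has derivative `y ^ 2 / (1 + y) ^ 3`.
  have hcurv : ∀ y : ℝ, 0 ≤ y → y ^ 2 / (2 * (1 + y) ^ 2) ≤ Real.log (1 + y) - y / (1 + y) := by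
    have hmono : MonotoneOn (fun y : ℝ => Real.log (1 + y) - y / (1 + y) - y ^ 2 / (2 * (1 + y) ^ 2))
        (Set.Ici 0) := by
      have hder : ∀ y : ℝ, 0 ≤ y → HasDerivAt
          (fun y : ℝ => Real.log (1 + y) - y / (1 + y) - y ^ 2 / (2 * (1 + y) ^ 2))
          (y ^ 2 / (1 + y) ^ 3) y := by
        intro y hy
        have h1 : HasDerivAt (fun y : ℝ => 1 + y) 1 y := (hasDerivAt_id y).const_add 1
        have h2 := (h1.log (by positivity)).sub ((hasDerivAt_id y).div h1 (by positivity))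
        have h3 := h2.sub (((hasDerivAt_id y).pow 2).div ((h1.pow 2).const_mul 2)
          (show 2 * (1 + y) ^ 2 ≠ 0 by positivity))
        refine h3.congr_deriv ?_
        simp only [id, Pi.pow_apply]
        field_simp
        ring
      apply monotoneOn_of_deriv_nonneg (convex_Ici 0)
      · exact fun y hy => (hder y hy).continuousAt.continuousWithinAt
      · intro y hy
        rw [interior_Ici] at hy
        exact (hder y (le_of_lt hy)).differentiableAt.differentiableWithinAt
      · intro y hy
        rw [interior_Ici] at hy
        have hy : 0 < y := hy
        rw [(hder y hy.le).deriv]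
        positivity
    intro y hy
    have := hmono (Set.self_mem_Ici) (Set.mem_Ici.2 hy) hy
    simp at this
    linarith
  have hanti : AntitoneOn (fun y : ℝ => Real.log (1 + y) / y - 1 / (2 * (1 + y))) (Set.Ioi 0) := by
    have hder : ∀ y : ℝ, 0 < y → HasDerivAt
        (fun y : ℝ => Real.log (1 + y) / y - 1 / (2 * (1 + y)))
        (-(Real.log (1 + y) - y / (1 + y) - y ^ 2 / (2 * (1 + y) ^ 2)) / y ^ 2) y := by
      intro y hy
      have h1 : HasDerivAt (fun y : ℝ => 1 + y) 1 y := (hasDerivAt_id y).const_add 1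
      have h2 := (h1.log (by positivity)).div (hasDerivAt_id y) hy.ne'
      have h3 := h2.sub ((hasDerivAt_const y (1 : ℝ)).div (h1.const_mul 2) (by positivity))
      refine h3.congr_deriv ?_
      simp only [id]
      field_simp
      ring
    apply antitoneOn_of_deriv_nonpos (convex_Ioi 0)
    · exact fun y hy => (hder y hy).continuousAt.continuousWithinAt
    · intro y hy
      rw [interior_Ioi] at hy
      exact (hder y hy).differentiableAt.differentiableWithinAt
    · intro y hy
      rw [interior_Ioi] at hy
      have hy : 0 < y := hy
      rw [(hder y hy).deriv]
      apply div_nonpos_of_nonpos_of_nonneg _ (by positivity)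
      linarith [hcurv y hy.le]
  have h := hanti (Set.mem_Ioi.2 hv) (Set.mem_Ioi.2 (hv.trans_le hvV)) hvV
  simp only at h
  have hV : 0 < V := hv.trans_le hvV
  have : (V - v) / (2 * (1 + v) * (1 + V)) = 1 / (2 * (1 + v)) - 1 / (2 * (1 + V)) := by
    field_simp
    ring
  linarith

lemma sq_mul_log_div_le {x V : ℝ} (hx : 0 ≤ x) (hxV : x ^ 2 ≤ V) :
    x ^ 2 * (Real.log (1 + V) / V) ≤ Real.log (1 + x ^ 2) := by
  rcases hx.eq_or_lt with rfl | hx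
  · simp
  have hx2 : 0 < x ^ 2 := by positivity
  have h := log_div_sub_log_div_ge hx2 hxV
  have h0 : 0 ≤ (V - x ^ 2) / (2 * (1 + x ^ 2) * (1 + V)) :=
    div_nonneg (by linarith) (by nlinarith)
  have h1 : Real.log (1 + V) / V ≤ Real.log (1 + x ^ 2) / x ^ 2 := by linarith
  calc _ ≤ x ^ 2 * (Real.log (1 + x ^ 2) / x ^ 2) := by gcongr
    _ = _ := by field_simp

/-! ### Perturbation of powers -/

lemma sq_mul_rpow_half {x h p : ℝ} (hx : 0 ≤ x) (hh : 0 ≤ h) :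
    (x ^ 2 * h) ^ (p / 2) = x ^ p * h ^ (p / 2) := by
  rw [Real.mul_rpow (by positivity) hh, ← Real.rpow_natCast x 2, ← Real.rpow_mul hx]
  congr 2
  push_cast
  ring

/-- Bernoulli's inequality for `(h'/h) ^ s`, combined with `h ≤ h ^ s` for `h ≤ 1`. It carries the
gain in slope over to powers with a constant independent of `p`. -/
lemma half_sub_le_rpow_sub_rpow {h h' s : ℝ} (h0 : 0 ≤ h') (hh : h' ≤ h) (h1 : h ≤ 1)
    (hs : 1 / 2 ≤ s) (hs1 : s ≤ 1) : (h - h') / 2 ≤ h ^ s - h' ^ s := by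
  rcases (h0.trans hh).eq_or_lt with h | hpos
  · obtain rfl : h' = 0 := by linarith
    simp [← h]
  have hb := rpow_one_add_le_one_add_mul_self (s := h' / h - 1) (by
    have : 0 ≤ h' / h := by positivity
    linarith) (p := s) (by linarith) hs1
  rw [add_sub_cancel, Real.div_rpow h0 hpos.le, div_le_iff₀ (by positivity)] at hb
  have hhs : h ≤ h ^ s := by
    simpa using Real.rpow_le_rpow_of_exponent_ge hpos h1 hs1
  have hq : 0 ≤ 1 - h' / h := by
    rw [sub_nonneg, div_le_one hpos]; exact hh
  have h3 : (h - h') = (1 - h' / h) * h := by field_simp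
  calc (h - h') / 2 = (1 / 2) * ((1 - h' / h) * h) := by rw [h3]; ring
    _ ≤ s * ((1 - h' / h) * h ^ s) := by gcongr
    _ ≤ _ := by linarith

/-- Bernoulli's inequality for `(x / (x + y)) ^ p`. The error is expressed through `r ^ p` because
the gain at the second largest entry `r` has that form. -/
lemma add_rpow_le_rpow_add_mul {x y r p C : ℝ} (hx : 0 ≤ x) (hxr : x ≤ r) (hy : 0 ≤ y)
    (hyr : y ≤ C * r) (hC : 0 ≤ C) (hp : 1 ≤ p) (hp2 : p ≤ 2) (hr : 0 < r) :
    (x + y) ^ p ≤ x ^ p + 2 * (1 + C) * (y / r) * r ^ p := by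
  rcases (add_nonneg hx hy).eq_or_lt with h | hpos
  · rw [← h, Real.zero_rpow (by linarith)]; positivity
  have hb := one_add_mul_self_le_rpow_one_add (s := -(y / (x + y))) (by
    rw [neg_le_neg_iff, div_le_one hpos]; linarith) hp
  have h1 : 1 + -(y / (x + y)) = x / (x + y) := by field_simp; ring
  rw [h1, Real.div_rpow hx hpos.le, le_div_iff₀ (by positivity)] at hb
  have h2 : (x + y) ^ p = (x + y) * (x + y) ^ (p - 1) := by
    rw [← Real.rpow_one_add' hpos.le (by linarith)]; congr 1; ring
  have h3 : (x + y) ^ (p - 1) ≤ (1 + C) * r ^ (p - 1) := by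
    calc (x + y) ^ (p - 1) ≤ ((1 + C) * r) ^ (p - 1) := by
          apply Real.rpow_le_rpow hpos.le _ (by linarith)
          linarith
      _ = (1 + C) ^ (p - 1) * r ^ (p - 1) := Real.mul_rpow (by positivity) hr.le
      _ ≤ (1 + C) ^ (1 : ℝ) * r ^ (p - 1) := by
          gcongr
          · linarith
          · linarith
      _ = _ := by rw [Real.rpow_one]
  have h4 : r ^ p = r * r ^ (p - 1) := by
    rw [← Real.rpow_one_add' hr.le (by linarith)]; congr 1; ring
  have h5 : p * (y / (x + y)) * (x + y) ^ p ≤ 2 * (1 + C) * (y / r) * r ^ p := by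
    calc p * (y / (x + y)) * (x + y) ^ p = p * (y * (x + y) ^ (p - 1)) := by
          rw [h2]; field_simp
      _ ≤ 2 * (y * ((1 + C) * r ^ (p - 1))) := by gcongr
      _ = _ := by rw [h4]; field_simp
  linarith

lemma real_add_rpow_le {x y s : ℝ} (hx : 0 ≤ x) (hy : 0 ≤ y) (hs : 0 ≤ s) (hs1 : s ≤ 1) :
    (x + y) ^ s ≤ x ^ s + y ^ s := by
  lift x to ℝ≥0 using hx
  lift y to ℝ≥0 using hy
  exact_mod_cast NNReal.rpow_add_le_add_rpow x y hs hs1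

lemma add_rpow_le_rpow_add_of_one_le {L y s : ℝ} (hL : 1 ≤ L) (hy : 0 ≤ y) (hs : 0 ≤ s)
    (hs1 : s ≤ 1) : (L + y) ^ s ≤ L ^ s + y := by
  have hL0 : 0 < L := by linarith
  have hb := rpow_one_add_le_one_add_mul_self (s := y / L) (by
    have : 0 ≤ y / L := by positivity
    linarith) hs hs1
  have h1 : 1 + y / L = (L + y) / L := by field_simp
  rw [h1, Real.div_rpow (by positivity) hL0.le, div_le_iff₀ (by positivity)] at hb
  have hLs : L ^ s ≤ L := by simpa using Real.rpow_le_rpow_of_exponent_le hL hs1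
  have h2 : s * (y / L) * L ^ s ≤ 1 * (y / L) * L := by gcongr
  have h3 : 1 * (y / L) * L = y := by field_simp
  linarith

/-- Summation of the individual estimates: a gain at `l` absorbs the errors at all indices. -/
lemma sum_le_sum_of_gain {d : ℕ} {f g : Fin d → ℝ} {l : Fin d} {δ γ : ℝ}
    (h : ∀ j, f j ≤ g j + δ - if j = l then γ else 0) (hδ : d * δ ≤ γ) :
    ∑ j, f j ≤ ∑ j, g j := by
  have h1 := Finset.sum_le_sum fun j (_ : j ∈ Finset.univ) => h j
  rw [Finset.sum_sub_distrib, Finset.sum_add_distrib, Finset.sum_ite_eq' Finset.univ l] at h1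
  simp at h1
  linarith

/-- The gain in the second largest term. -/
lemma log_one_add_sq_rpow_gain {r V p : ℝ} (hr : 0 ≤ r) (hV : 0 < V) (hrV : r ^ 2 ≤ V)
    (hp : 1 ≤ p) (hp2 : p ≤ 2) :
    r ^ p * (Real.log (1 + V) / V) ^ (p / 2) +
        (V - r ^ 2) / (4 * (1 + r ^ 2) * (1 + V)) * r ^ p ≤ Real.log (1 + r ^ 2) ^ (p / 2) := by
  rcases hr.eq_or_lt with rfl | hr
  · rw [Real.zero_rpow (by linarith)]
    simp [Real.zero_rpow (by linarith : p / 2 ≠ 0)]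
  have hr2 : 0 < r ^ 2 := by positivity
  have h1 := log_div_sub_log_div_ge hr2 hrV
  have hVn : 0 ≤ Real.log (1 + V) / V := div_nonneg (Real.log_nonneg (by linarith)) hV.le
  have h0 : 0 ≤ (V - r ^ 2) / (2 * (1 + r ^ 2) * (1 + V)) :=
    div_nonneg (by linarith) (by positivity)
  have h2 := half_sub_le_rpow_sub_rpow (s := p / 2) hVn
    (by linarith : _ ≤ Real.log (1 + r ^ 2) / r ^ 2) (log_one_add_div_le_one hr2) (by linarith)
    (by linarith)
  have h3 : Real.log (1 + r ^ 2) ^ (p / 2) =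
      r ^ p * (Real.log (1 + r ^ 2) / r ^ 2) ^ (p / 2) := by
    rw [← sq_mul_rpow_half hr.le (by linarith)]
    congr 1
    field_simp
  have h4 : (V - r ^ 2) / (4 * (1 + r ^ 2) * (1 + V)) =
      (V - r ^ 2) / (2 * (1 + r ^ 2) * (1 + V)) / 2 := by
    field_simp
    ring
  rw [h3, h4]
  have hrp : 0 ≤ r ^ p := by positivity
  nlinarith [mul_le_mul_of_nonneg_left h2 hrp, mul_le_mul_of_nonneg_left h1 hrp]

/-! ### Comparison of linearised and logarithmic sums -/

lemma sq_add_sq_le_sum_sq {d : ℕ} (ξ : Fin d → ℝ) {m l : Fin d} (hml : l ≠ m) :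
    ξ m ^ 2 + ξ l ^ 2 ≤ ∑ j, ξ j ^ 2 := by
  rw [← Finset.add_sum_erase _ _ (Finset.mem_univ m)]
  gcongr
  exact Finset.single_le_sum (f := fun j => ξ j ^ 2) (fun j _ => sq_nonneg _)
    (Finset.mem_erase.2 ⟨hml, Finset.mem_univ l⟩)

lemma sum_sq_le_card_mul {d : ℕ} {ξ : Fin d → ℝ} {μ : ℝ} (hξ : ∀ j, 0 ≤ ξ j)
    (hμ : ∀ j, ξ j ≤ μ) : ∑ j, ξ j ^ 2 ≤ d * μ ^ 2 := by
  calc ∑ j, ξ j ^ 2 ≤ ∑ j : Fin d, μ ^ 2 :=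
        Finset.sum_le_sum fun j _ => pow_le_pow_left₀ (hξ j) (hμ j) 2
    _ = _ := by simp

/-- Perturbed comparison of the linearised terms with the logarithmic ones, when the largest entry
`ξ m` is moderate and the others are at most `r = ξ l`. -/
theorem sum_rpow_le_of_small {d : ℕ} {ξ γ : Fin d → ℝ} {m l : Fin d} {ε C K c p V : ℝ}
    (hml : l ≠ m) (hξ : ∀ j, 0 ≤ ξ j) (hγ : ∀ j, 0 ≤ γ j) (hm : 0 < ξ m)
    (hl : ∀ j, j ≠ m → ξ j ≤ ξ l) (hlm : ξ l ≤ ξ m) (hK : ξ l ≤ K) (hC : 0 ≤ C)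
    (hV : V = ∑ j, ξ j ^ 2) (hp : 1 ≤ p) (hp2 : p ≤ 2) (hε : 0 < ε)
    (hγm : γ m ≤ ξ m * (1 + C * (ε * ξ l) ^ 2))
    (hγj : ∀ j, j ≠ m → γ j ≤ ξ j + C * (ε * ξ m) ^ 2 * ξ l)
    (hc1 : c ≤ 1) (hM : ε * ξ m ≤ c) (hεc : ε ≤ c)
    (hc : 8 * d * (C * (1 + C)) * (1 + K ^ 2) * ((1 + d) * c ^ 2) ≤ 1) :
    ∑ j, (1 / (1 + V) * γ j ^ 2 + ξ j ^ 2 * (Real.log (1 + V) / V - 1 / (1 + V))) ^ (p / 2) ≤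
      ∑ j, Real.log (1 + ξ j ^ 2) ^ (p / 2) := by
  set μ := ξ m with hμ
  set r := ξ l with hr
  have hr0 : 0 ≤ r := hξ l
  have hd1 : (1 : ℝ) ≤ d := by
    have : 0 < d := m.pos
    exact_mod_cast this
  have hV2 : μ ^ 2 + r ^ 2 ≤ V := hV ▸ sq_add_sq_le_sum_sq ξ hml
  have hVd : V ≤ d * μ ^ 2 := hV ▸ sum_sq_le_card_mul hξ fun j => by
    by_cases h : j = m
    · rw [h]
    · exact (hl j h).trans hlm
  have hV0 : 0 < V := lt_of_lt_of_le (by positivity) hV2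
  have hξV : ∀ j, ξ j ^ 2 ≤ V := fun j => by
    rw [hV]
    exact Finset.single_le_sum (f := fun j => ξ j ^ 2) (fun j _ => sq_nonneg _) (Finset.mem_univ j)
  set h := Real.log (1 + V) / V with hh
  set s := 1 / (1 + V) with hs
  have hs0 : 0 < s := by positivity
  have hsh : s ≤ h := inv_one_add_le_log_div hV0
  have hh1 : h ≤ 1 := log_one_add_div_le_one hV0
  have hh0 : 0 < h := hs0.trans_le hsh
  set M := ε * μ with hMdef
  have hM0 : 0 < M := by positivity
  have hc0 : 0 < c := hM0.trans_le hM
  have hM1 : M ≤ 1 := hM.trans hc1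
  have hεr : ε * r ≤ 1 := (mul_le_mul_of_nonneg_left hlm hε.le).trans hM1
  have hε2 : ε ^ 2 ≤ c ^ 2 := by gcongr
  have hM2 : M ^ 2 ≤ c ^ 2 := by gcongr
  have hεr2 : (ε * r) ^ 2 ≤ 1 := pow_le_one₀ (by positivity) hεr
  have hrp : 0 ≤ r ^ p := by positivity
  have hN0 : ∀ j, 0 ≤ s * γ j ^ 2 + ξ j ^ 2 * (h - s) := fun j => by
    have : 0 ≤ h - s := by linarith
    positivity
  apply sum_le_sum_of_gain (l := l) (δ := 2 * (C * (1 + C)) * M ^ 2 * r ^ p)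
    (γ := (V - r ^ 2) / (4 * (1 + r ^ 2) * (1 + V)) * r ^ p)
  · intro j
    by_cases hj : j = m
    · subst hj
      rw [if_neg (Ne.symm hml), sub_zero]
      refine le_add_of_le_of_nonneg ?_ (by positivity)
      apply Real.rpow_le_rpow (hN0 j) _ (by linarith)
      rw [← hμ]
      have h1 := log_div_sub_log_div_ge (by positivity : 0 < μ ^ 2) (hξV j)
      rw [← hh] at h1
      have h2 : γ j ^ 2 ≤ μ ^ 2 + 2 * (C * (1 + C)) * (ε * r) ^ 2 * μ ^ 2 := by
        calc γ j ^ 2 ≤ (μ * (1 + C * (ε * r) ^ 2)) ^ 2 := by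
              have := hγ j
              gcongr
          _ = μ ^ 2 + (2 * C + C ^ 2 * (ε * r) ^ 2) * (ε * r) ^ 2 * μ ^ 2 := by ring
          _ ≤ μ ^ 2 + (2 * C + C ^ 2 * 1) * (ε * r) ^ 2 * μ ^ 2 := by gcongr
          _ ≤ μ ^ 2 + 2 * (C * (1 + C)) * (ε * r) ^ 2 * μ ^ 2 := by
              have : 2 * C + C ^ 2 * 1 ≤ 2 * (C * (1 + C)) := by linarith [sq_nonneg C]
              gcongr
      have h3 : Real.log (1 + μ ^ 2) = μ ^ 2 * (Real.log (1 + μ ^ 2) / μ ^ 2) := by field_simp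
      -- The term at `m` pays for its own error: its slope gain is proportional to `V - μ ^ 2 ≥ r ^
      -- 2`, and the error is of order `r ^ 2` with a small factor.
      have h4 : 2 * (C * (1 + C)) * (ε * r) ^ 2 * s ≤
          (V - μ ^ 2) / (2 * (1 + μ ^ 2) * (1 + V)) := by
        have h5 : (V - μ ^ 2) / (2 * (1 + μ ^ 2) * (1 + V)) =
            (V - μ ^ 2) / (2 * (1 + μ ^ 2)) * s := by rw [hs]; field_simp
        rw [h5]
        gcongr
        rw [le_div_iff₀ (by positivity)]
        have h6 : 8 * 1 * (C * (1 + C)) * (1 + 0) * ((1 + 1) * c ^ 2) ≤ 1 :=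
          le_trans (by gcongr; positivity) hc
        calc 2 * (C * (1 + C)) * (ε * r) ^ 2 * (2 * (1 + μ ^ 2))
            = r ^ 2 * (4 * (C * (1 + C)) * (ε ^ 2 + M ^ 2)) := by rw [hMdef]; ring
          _ ≤ r ^ 2 * (4 * (C * (1 + C)) * (c ^ 2 + c ^ 2)) := by gcongr
          _ ≤ r ^ 2 * 1 := by
              gcongr
              have : 0 ≤ C * (1 + C) * c ^ 2 := by positivity
              linarith
          _ ≤ _ := by linarith
      have h7 := mul_le_mul_of_nonneg_left h2 hs0.le
      have h8 := mul_le_mul_of_nonneg_left (h4.trans h1) (sq_nonneg μ)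
      rw [h3]
      linear_combination h7 + h8
    · have hxr := hl j hj
      have hNj : s * γ j ^ 2 + ξ j ^ 2 * (h - s) ≤ (ξ j + C * M ^ 2 * r) ^ 2 * h := by
        have h1 : γ j ^ 2 ≤ (ξ j + C * M ^ 2 * r) ^ 2 := by
          have := hγ j
          have := hγj j hj
          gcongr
        have h2 : ξ j ^ 2 ≤ (ξ j + C * M ^ 2 * r) ^ 2 := by
          have := hξ j
          gcongr
          exact le_add_of_nonneg_right (by positivity)
        have h3 : 0 ≤ h - s := by linarith
        linear_combination mul_le_mul_of_nonneg_left h1 hs0.le + mul_le_mul_of_nonneg_right h2 h3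
      have hpow : (s * γ j ^ 2 + ξ j ^ 2 * (h - s)) ^ (p / 2) ≤
          ξ j ^ p * h ^ (p / 2) + 2 * (C * (1 + C)) * M ^ 2 * r ^ p := by
        have hb : 0 ≤ ξ j + C * M ^ 2 * r := add_nonneg (hξ j) (by positivity)
        refine (Real.rpow_le_rpow (hN0 j) hNj (by linarith)).trans ?_
        rw [sq_mul_rpow_half hb hh0.le]
        have hhp : h ^ (p / 2) ≤ 1 := Real.rpow_le_one hh0.le hh1 (by linarith)
        have hhp0 : 0 ≤ h ^ (p / 2) := by positivity
        rcases hr0.eq_or_lt with h0 | hrpos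
        · rw [← h0] at hxr ⊢
          have : ξ j = 0 := le_antisymm hxr (hξ j)
          rw [this]
          simp [Real.zero_rpow (by linarith : p ≠ 0)]
        have hCM : C * M ^ 2 * r ≤ C * r := by
          have : M ^ 2 ≤ 1 := pow_le_one₀ hM0.le hM1
          have : C * M ^ 2 ≤ C * 1 := by gcongr
          rw [mul_one] at this
          gcongr
        have h1 := add_rpow_le_rpow_add_mul (hξ j) hxr (by positivity) hCM hC hp hp2 hrpos
        have h2 : 2 * (1 + C) * (C * M ^ 2 * r / r) * r ^ p =
            2 * (C * (1 + C)) * M ^ 2 * r ^ p := by field_simp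
        rw [h2] at h1
        have h3 := mul_le_mul_of_nonneg_right h1 hhp0
        have h4 : 0 ≤ 2 * (C * (1 + C)) * M ^ 2 * r ^ p := by positivity
        have h5 := mul_le_mul_of_nonneg_left hhp h4
        linarith
      refine hpow.trans ?_
      split_ifs with hjl
      · subst hjl
        have := log_one_add_sq_rpow_gain hr0 hV0 (hξV j) hp hp2
        rw [← hh] at this
        linarith
      · rw [← sq_mul_rpow_half (hξ j) hh0.le, sub_zero]
        gcongr
        exact sq_mul_log_div_le (hξ j) (hξV j)
  · rw [← mul_assoc]
    gcongr
    rw [le_div_iff₀ (by positivity)]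
    have hrK : r ^ 2 ≤ K ^ 2 := by gcongr
    have hεM : ε ^ 2 + d * M ^ 2 ≤ (1 + d) * c ^ 2 := by
      calc ε ^ 2 + d * M ^ 2 ≤ c ^ 2 + d * c ^ 2 := by gcongr
        _ = _ := by ring
    calc d * (2 * (C * (1 + C)) * M ^ 2) * (4 * (1 + r ^ 2) * (1 + V))
        ≤ d * (2 * (C * (1 + C)) * M ^ 2) * (4 * (1 + K ^ 2) * (1 + d * μ ^ 2)) := by gcongr
      _ = μ ^ 2 * (8 * d * (C * (1 + C)) * (1 + K ^ 2) * (ε ^ 2 + d * M ^ 2)) := by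
          rw [hMdef]; ring
      _ ≤ μ ^ 2 * (8 * d * (C * (1 + C)) * (1 + K ^ 2) * ((1 + d) * c ^ 2)) := by gcongr
      _ ≤ μ ^ 2 * 1 := by gcongr
      _ ≤ V - r ^ 2 := by linarith

/-- The counterpart of `sum_rpow_le_of_small` when the largest entry is large. -/
theorem sum_rpow_le_of_large {d : ℕ} {ξ γ : Fin d → ℝ} {m l : Fin d} {ε C K c p V : ℝ}
    (hml : l ≠ m) (hξ : ∀ j, 0 ≤ ξ j) (hγ : ∀ j, 0 ≤ γ j)
    (hl : ∀ j, j ≠ m → ξ j ≤ ξ l) (hlm : ξ l ≤ ξ m) (hK : ξ l ≤ K) (hK1 : 1 ≤ K) (hC : 0 ≤ C)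
    (hV : V = ∑ j, ξ j ^ 2) (hp : 1 ≤ p) (hp2 : p ≤ 2) (hε : 0 < ε)
    (hγm : γ m ≤ ξ m * (1 + C * (ε * ξ l) ^ 2))
    (hγj : ∀ j, j ≠ m → γ j ≤ C * (√(1 + (ε * ξ m) ^ 2) * ξ l))
    (hc0 : 0 < c) (hM : c ≤ ε * ξ m) (hεc : 2 * ε ≤ c) (hεK : ε * K ≤ 1)
    (hεC : C * (1 + 1 / c) * ε ≤ 1)
    (hεd : d * ((C * (1 + 1 / c) + 2 * (C * (1 + C)) * K) * ε) *
      (4 * (1 + K ^ 2) * (1 + d)) ≤ 1) :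
    ∑ j, (1 / (1 + V) * γ j ^ 2 + ξ j ^ 2 * (Real.log (1 + V) / V - 1 / (1 + V))) ^ (p / 2) ≤
      ∑ j, Real.log (1 + ξ j ^ 2) ^ (p / 2) := by
  set μ := ξ m with hμ
  set r := ξ l with hr
  have hr0 : 0 ≤ r := hξ l
  have hμ2 : 2 ≤ μ := by
    have : ε * 2 ≤ ε * μ := by linarith
    exact le_of_mul_le_mul_left this hε
  have hd1 : (1 : ℝ) ≤ d := by
    have : 0 < d := m.pos
    exact_mod_cast this
  have hV2 : μ ^ 2 + r ^ 2 ≤ V := hV ▸ sq_add_sq_le_sum_sq ξ hml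
  have hVd : V ≤ d * μ ^ 2 := hV ▸ sum_sq_le_card_mul hξ fun j => by
    by_cases h : j = m
    · rw [h]
    · exact (hl j h).trans hlm
  have hV0 : 0 < V := lt_of_lt_of_le (by positivity) hV2
  have hξV : ∀ j, ξ j ^ 2 ≤ V := fun j => by
    rw [hV]
    exact Finset.single_le_sum (f := fun j => ξ j ^ 2) (fun j _ => sq_nonneg _) (Finset.mem_univ j)
  set h := Real.log (1 + V) / V with hh
  set s := 1 / (1 + V) with hs
  have hs0 : 0 < s := by positivity
  have hsh : s ≤ h := inv_one_add_le_log_div hV0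
  have hh0 : 0 < h := hs0.trans_le hsh
  set M := ε * μ with hMdef
  have hM0 : 0 < M := by positivity
  have hε1 : ε ≤ 1 := (le_mul_of_one_le_right hε.le hK1).trans hεK
  have hεr : ε * r ≤ 1 := (mul_le_mul_of_nonneg_left hK hε.le).trans hεK
  have hεr2 : (ε * r) ^ 2 ≤ 1 := pow_le_one₀ (by positivity) hεr
  have hrp : 0 ≤ r ^ p := by positivity
  have hsμ : s * μ ^ 2 ≤ 1 := by
    rw [hs, one_div, inv_mul_le_iff₀ (by positivity)]
    linarith [sq_nonneg r]
  have hμ4 : 2 ^ 2 ≤ μ ^ 2 := by gcongr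
  set C₁ := C * (1 + 1 / c) with hC₁
  have hC₁0 : 0 ≤ C₁ := by positivity
  set C₂ := 2 * (C * (1 + C)) with hC₂
  have hC₂0 : 0 ≤ C₂ := by positivity
  have hN0 : ∀ j, 0 ≤ s * γ j ^ 2 + ξ j ^ 2 * (h - s) := fun j => by
    have : 0 ≤ h - s := by linarith
    positivity
  have hdrop : ∀ j, s * γ j ^ 2 + ξ j ^ 2 * (h - s) ≤ ξ j ^ 2 * h + s * γ j ^ 2 := fun j => by
    have : 0 ≤ ξ j ^ 2 * s := by positivity
    linarith
  apply sum_le_sum_of_gain (l := l) (δ := (C₁ + C₂ * K) * ε * r ^ p)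
    (γ := (V - r ^ 2) / (4 * (1 + r ^ 2) * (1 + V)) * r ^ p)
  · intro j
    by_cases hj : j = m
    · subst hj
      rw [if_neg (Ne.symm hml), sub_zero, ← hμ]
      have h2 : γ j ^ 2 ≤ μ ^ 2 + C₂ * (ε * r) ^ 2 * μ ^ 2 := by
        calc γ j ^ 2 ≤ (μ * (1 + C * (ε * r) ^ 2)) ^ 2 := by
              have := hγ j
              gcongr
          _ = μ ^ 2 + (2 * C + C ^ 2 * (ε * r) ^ 2) * (ε * r) ^ 2 * μ ^ 2 := by ring
          _ ≤ μ ^ 2 + (2 * C + C ^ 2 * 1) * (ε * r) ^ 2 * μ ^ 2 := by gcongr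
          _ ≤ μ ^ 2 + C₂ * (ε * r) ^ 2 * μ ^ 2 := by
              have : 2 * C + C ^ 2 * 1 ≤ C₂ := by rw [hC₂]; linarith [sq_nonneg C]
              gcongr
      have h3 : s * γ j ^ 2 + μ ^ 2 * (h - s) ≤
          Real.log (1 + μ ^ 2) + C₂ * (ε * r) ^ 2 := by
        have h4 := mul_le_mul_of_nonneg_left h2 hs0.le
        have h5 := sq_mul_log_div_le (hξ j) (hξV j)
        rw [← hμ, ← hh] at h5
        have h6 := mul_le_mul_of_nonneg_left hsμ (by positivity : 0 ≤ C₂ * (ε * r) ^ 2)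
        linear_combination h4 + h5 + h6
      -- Since `μ ≥ 2`, the logarithm is at least `log 5 > 1`, so an additive error inside the power
      -- comes out at most unchanged. Here the error at `m` is charged to the gain at `l`.
      have hL : 1 ≤ Real.log (1 + μ ^ 2) := by
        rw [Real.le_log_iff_exp_le (by positivity)]
        linarith [Real.exp_one_lt_three]
      refine (Real.rpow_le_rpow (hN0 j) h3 (by linarith)).trans ?_
      refine (add_rpow_le_rpow_add_of_one_le hL (by positivity) (by linarith)
        (by linarith)).trans ?_
      refine add_le_add le_rfl ?_
      have hr2 : r ^ 2 ≤ K * r ^ p := by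
        rcases hr0.eq_or_lt with h0 | hrpos
        · rw [← h0]; simp; positivity
        calc r ^ 2 = r ^ (2 - p) * r ^ p := by
              rw [← Real.rpow_add hrpos, sub_add_cancel]; norm_cast
          _ ≤ K ^ (2 - p) * r ^ p := by gcongr
          _ ≤ K ^ (1 : ℝ) * r ^ p := by gcongr; linarith
          _ = _ := by rw [Real.rpow_one]
      have hε2 : ε ^ 2 ≤ ε := pow_le_of_le_one hε.le hε1 two_ne_zero
      calc C₂ * (ε * r) ^ 2 = C₂ * (ε ^ 2 * r ^ 2) := by ring
        _ ≤ C₂ * (ε * (K * r ^ p)) := by gcongr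
        _ ≤ C₂ * (ε * (K * r ^ p)) + C₁ * (ε * r ^ p) :=
            le_add_of_nonneg_right (by positivity)
        _ = _ := by ring
    · have hNj : s * γ j ^ 2 ≤ (C₁ * ε * r) ^ 2 := by
        have h1 : γ j ^ 2 ≤ C ^ 2 * (1 + M ^ 2) * r ^ 2 := by
          calc γ j ^ 2 ≤ (C * (√(1 + M ^ 2) * r)) ^ 2 := by
                have := hγ j
                have := hγj j hj
                gcongr
            _ = C ^ 2 * (√(1 + M ^ 2)) ^ 2 * r ^ 2 := by ring
            _ = _ := by rw [Real.sq_sqrt (by positivity)]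
        have h2 : 1 + M ^ 2 ≤ (1 + 1 / c) ^ 2 * M ^ 2 := by
          have h3 : 1 ≤ 1 / c * M := by
            rw [one_div, inv_mul_eq_div, one_le_div hc0]; exact hM
          have h4 : 0 ≤ 1 / c * M := by linarith
          have h5 : 1 ≤ (1 / c * M) ^ 2 := one_le_pow₀ h3
          linear_combination h5 + 2 * mul_nonneg h4 hM0.le
        calc s * γ j ^ 2 ≤ s * (C ^ 2 * ((1 + 1 / c) ^ 2 * M ^ 2) * r ^ 2) := by
              gcongr
              exact h1.trans (by gcongr)
          _ = (C₁ * ε * r) ^ 2 * (s * μ ^ 2) := by rw [hC₁, hMdef]; ring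
          _ ≤ (C₁ * ε * r) ^ 2 * 1 := by gcongr
          _ = _ := mul_one _
      have hpow : (s * γ j ^ 2 + ξ j ^ 2 * (h - s)) ^ (p / 2) ≤
          ξ j ^ p * h ^ (p / 2) + (C₁ + C₂ * K) * ε * r ^ p := by
        have h1 : s * γ j ^ 2 + ξ j ^ 2 * (h - s) ≤ ξ j ^ 2 * h + (C₁ * ε * r) ^ 2 * 1 := by
          linarith [hdrop j]
        refine (Real.rpow_le_rpow (hN0 j) h1 (by linarith)).trans ?_
        refine (real_add_rpow_le (mul_nonneg (sq_nonneg _) hh0.le) (by positivity) (by linarith)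
          (by linarith)).trans ?_
        rw [sq_mul_rpow_half (hξ j) hh0.le, sq_mul_rpow_half (by positivity) zero_le_one,
          Real.one_rpow, mul_one, Real.mul_rpow (by positivity) hr0]
        gcongr
        calc (C₁ * ε) ^ p ≤ (C₁ * ε) ^ (1 : ℝ) := by
              rcases (by positivity : 0 ≤ C₁ * ε).eq_or_lt with h0 | h0
              · rw [← h0, Real.zero_rpow (by linarith), Real.rpow_one]
              · exact Real.rpow_le_rpow_of_exponent_ge h0 hεC hp
          _ = C₁ * ε := Real.rpow_one _
          _ ≤ (C₁ + C₂ * K) * ε := by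
              gcongr
              exact le_add_of_nonneg_right (by positivity)
      refine hpow.trans ?_
      split_ifs with hjl
      · subst hjl
        have := log_one_add_sq_rpow_gain hr0 hV0 (hξV j) hp hp2
        rw [← hh] at this
        linarith
      · rw [← sq_mul_rpow_half (hξ j) hh0.le, sub_zero]
        gcongr
        exact sq_mul_log_div_le (hξ j) (hξV j)
  · rw [← mul_assoc]
    gcongr
    rw [le_div_iff₀ (by positivity)]
    have hrK : r ^ 2 ≤ K ^ 2 := by gcongr
    have hμ1 : 1 ≤ μ ^ 2 := by linarith
    calc d * ((C₁ + C₂ * K) * ε) * (4 * (1 + r ^ 2) * (1 + V))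
        ≤ d * ((C₁ + C₂ * K) * ε) * (4 * (1 + K ^ 2) * (μ ^ 2 + d * μ ^ 2)) := by gcongr
      _ = μ ^ 2 * (d * ((C₁ + C₂ * K) * ε) * (4 * (1 + K ^ 2) * (1 + d))) := by ring
      _ ≤ μ ^ 2 * 1 := by gcongr
      _ ≤ V - r ^ 2 := by linarith

/-! ### Choice of parameters and the two regimes -/

/-- The threshold `c = 1/Q` is fixed first by the condition quadratic in `c`; then `ε = 1/W` is
taken small in terms of `1/c`, with `W` the sum of all the quantities that `1/ε` has to dominate. -/
lemma exists_small_parameters {d C K : ℝ} (hd : 1 ≤ d) (hC : 1 ≤ C) (hK : 1 ≤ K) :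
    ∃ ε c : ℝ, 0 < ε ∧ 0 < c ∧ c ≤ 1 ∧ 2 * ε ≤ c ∧ d * (ε * K) ≤ 1 ∧
      8 * d * (C * (1 + C)) * (1 + K ^ 2) * ((1 + d) * c ^ 2) ≤ 1 ∧
      C * (1 + 1 / c) * ε ≤ 1 ∧
      d * ((C * (1 + 1 / c) + 2 * (C * (1 + C)) * K) * ε) * (4 * (1 + K ^ 2) * (1 + d)) ≤ 1 := by
  set Q := 8 * d * (C * (1 + C)) * (1 + K ^ 2) * (1 + d) with hQ
  have hQ1 : 1 ≤ Q := by
    have : 8 * 1 * (1 * (1 + 1)) * (1 + 0) * (1 + 1) ≤ Q := by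
      rw [hQ]
      gcongr
      positivity
    linarith
  set R := d * (C * (1 + Q) + 2 * (C * (1 + C)) * K) * (4 * (1 + K ^ 2) * (1 + d)) with hR
  have hR0 : 0 ≤ R := by positivity
  have hS0 : 0 ≤ C * (1 + Q) := by positivity
  have hT0 : 0 ≤ d * K := by positivity
  set W := 2 * Q + C * (1 + Q) + d * K + R with hW
  have hW0 : 0 < W := by positivity
  refine ⟨1 / W, 1 / Q, by positivity, by positivity, ?_, ?_, ?_, ?_, ?_, ?_⟩
  · rw [div_le_one (by positivity)]; exact hQ1
  · rw [mul_one_div, div_le_div_iff₀ hW0 (by positivity)]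
    linarith
  · rw [show d * (1 / W * K) = d * K / W by ring, div_le_one hW0]
    linarith
  · rw [show 8 * d * (C * (1 + C)) * (1 + K ^ 2) * ((1 + d) * (1 / Q) ^ 2) = Q * (1 / Q) ^ 2 by
      rw [hQ]; ring, show Q * (1 / Q) ^ 2 = 1 / Q by field_simp, div_le_one (by positivity)]
    exact hQ1
  · rw [one_div_one_div, mul_one_div, div_le_one hW0]
    linarith
  · rw [one_div_one_div, show d * ((C * (1 + Q) + 2 * (C * (1 + C)) * K) * (1 / W)) *
      (4 * (1 + K ^ 2) * (1 + d)) = R / W by rw [hR]; ring, div_le_one hW0]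
    linarith

lemma rpow_sum_le_sum_rpow {ι : Type*} (s : Finset ι) {f : ι → ℝ} (hf : ∀ j, 0 ≤ f j) {r : ℝ}
    (hr : 0 < r) (hr1 : r ≤ 1) : (∑ j ∈ s, f j) ^ r ≤ ∑ j ∈ s, f j ^ r := by
  classical
  induction s using Finset.induction_on with
  | empty => simp [Real.zero_rpow hr.ne']
  | insert i s hi ih =>
    rw [Finset.sum_insert hi, Finset.sum_insert hi]
    exact (real_add_rpow_le (hf i) (Finset.sum_nonneg fun j _ => hf j) hr.le hr1).trans
      (by gcongr)

/-- If every `y k` is at most the sum of the `f j`, then the power mean inequality holds for every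
pair of exponents. -/
lemma power_mean_le_of_le_sum {d : ℕ} (hd : d ≠ 0) {y f : Fin d → ℝ} (hy : ∀ k, 0 ≤ y k)
    (hf : ∀ j, 0 ≤ f j) (hyf : ∀ k, y k ≤ ∑ j, f j) {p q : ℝ} (hpq : p.HolderConjugate q)
    (hp2 : p ≤ 2) :
    ((1 / (d : ℝ)) * ∑ k, y k ^ (q / 2)) ^ (1 / q) ≤ (∑ j, f j ^ (p / 2)) ^ (1 / p) := by
  have hp0 := hpq.pos
  have hq0 := hpq.symm.pos
  have hd0 : (0 : ℝ) < d := by exact_mod_cast Nat.pos_of_ne_zero hd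
  set F := ∑ j, f j with hF
  have hF0 : 0 ≤ F := Finset.sum_nonneg fun j _ => hf j
  have hhalf : ∀ {r : ℝ}, 0 < r → (F ^ (r / 2)) ^ (1 / r) = F ^ (1 / 2 : ℝ) := by
    intro r hr
    rw [← Real.rpow_mul hF0]
    congr 1
    field_simp
  have hsum : ∑ k, y k ^ (q / 2) ≤ d * F ^ (q / 2) := by
    calc ∑ k, y k ^ (q / 2) ≤ ∑ k : Fin d, F ^ (q / 2) :=
          Finset.sum_le_sum fun k _ => Real.rpow_le_rpow (hy k) (hyf k) (by positivity)
      _ = _ := by simp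
  have hs0 : 0 ≤ ∑ k, y k ^ (q / 2) := Finset.sum_nonneg fun k _ => Real.rpow_nonneg (hy k) _
  calc _ ≤ (F ^ (q / 2)) ^ (1 / q) := by
        apply Real.rpow_le_rpow (by positivity) _ (by positivity)
        rw [one_div, inv_mul_le_iff₀ hd0]
        exact hsum
    _ = (F ^ (p / 2)) ^ (1 / p) := by rw [hhalf hq0, hhalf hp0]
    _ ≤ _ := by
        apply Real.rpow_le_rpow (by positivity) _ (by positivity)
        exact rpow_sum_le_sum_rpow _ hf (by positivity) (by linarith)

/-- When two of the `b j` are large compared with `ε`, the logarithmic size of the product is at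
most the sum of the logarithmic sizes of the factors. -/
lemma log_one_add_le_sum_of_two_large {d : ℕ} {a b A B : Fin d → ℂ}
    (hab : ∀ j, su11Matrix (a j) (b j) ∈ SU11)
    (hprod : ∀ k : Fin d, su11Matrix (A k) (B k) = twistedProduct d k a b)
    {m l : Fin d} (hml : l ≠ m) (hm : ∀ j, ‖b j‖ ≤ ‖b m‖) {ε : ℝ} (hε : 0 < ε) (hε1 : ε ≤ 1)
    (hεd : ε * (2 * 2 ^ d) ≤ 1) (hl : 2 * 2 ^ d * ε ≤ ‖b l‖) (k : Fin d) :
    Real.log (1 + (‖B k‖ / ε) ^ 2) ≤ ∑ j, Real.log (1 + (‖b j‖ / ε) ^ 2) := by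
  set s := Finset.univ.erase m with hs
  have hls : l ∈ s := Finset.mem_erase.2 ⟨hml, Finset.mem_univ l⟩
  set M := ‖b m‖ with hM
  have hB : ‖B k‖ ≤ 2 ^ d * (M * ∏ j ∈ s, √(1 + ‖b j‖ ^ 2)) := by
    refine (norm_le_sinh_sum_arsinh hab hprod k).trans ?_
    rw [← Finset.add_sum_erase _ _ (Finset.mem_univ m)]
    refine (sinh_add_sum_le s fun j _ => ⟨Real.arsinh_nonneg_iff.2 (norm_nonneg _),
      Real.arsinh_le_arsinh.2 (hm j)⟩).trans ?_
    simp only [Real.sinh_arsinh, Real.cosh_arsinh]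
    gcongr
    · norm_num
    · exact (Finset.card_le_univ s).trans_eq (Fintype.card_fin d)
  have hB2 : ‖B k‖ ^ 2 ≤ M ^ 2 * (4 ^ d * ∏ j ∈ s, (1 + ‖b j‖ ^ 2)) := by
    calc ‖B k‖ ^ 2 ≤ (2 ^ d * (M * ∏ j ∈ s, √(1 + ‖b j‖ ^ 2))) ^ 2 := by gcongr
      _ = M ^ 2 * ((2 ^ d) ^ 2 * ∏ j ∈ s, √(1 + ‖b j‖ ^ 2) ^ 2) := by
          rw [Finset.prod_pow]; ring
      _ = _ := by
          rw [← pow_mul, mul_comm d 2, pow_mul]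
          congr 2
          · norm_num
          · exact Finset.prod_congr rfl fun j _ => Real.sq_sqrt (by positivity)
  have hle : ∀ j, ‖b j‖ ^ 2 ≤ (‖b j‖ / ε) ^ 2 := fun j => by
    gcongr
    exact le_div_self (norm_nonneg _) hε hε1
  -- The factor at `l` alone absorbs the loss `4 ^ d` from the crude product bound; this fixes the
  -- threshold `2 * 2 ^ d * ε`.
  have hlbig : 4 ^ d * (1 + ‖b l‖ ^ 2) ≤ 1 + (‖b l‖ / ε) ^ 2 := by
    have h4 : (4 : ℝ) ^ d = (2 ^ d) ^ 2 := by
      rw [← pow_mul, mul_comm d 2, pow_mul]; norm_num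
    set T : ℝ := 2 ^ d with hT
    have hT0 : 0 < T := by positivity
    set z := ‖b l‖ / ε with hz
    have hzl : ‖b l‖ = ε * z := by rw [hz]; field_simp
    have hz1 : 2 * T ≤ z := by rw [hz, le_div_iff₀ hε]; exact hl
    have hz2 : (2 * T) ^ 2 ≤ z ^ 2 := by gcongr
    have hε2 : (ε * (2 * T)) ^ 2 ≤ 1 := pow_le_one₀ (by positivity) hεd
    rw [h4, hzl]
    linear_combination (1 / 4) * hz2 + (z ^ 2 / 4) * hε2 + (1 / 2) * sq_nonneg z
  have hPl : 4 ^ d * ∏ j ∈ s, (1 + ‖b j‖ ^ 2) ≤ ∏ j ∈ s, (1 + (‖b j‖ / ε) ^ 2) := by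
    rw [← Finset.mul_prod_erase _ _ hls, ← Finset.mul_prod_erase _ _ hls, ← mul_assoc]
    apply mul_le_mul hlbig _ (Finset.prod_nonneg fun j _ => by positivity) (by positivity)
    refine Finset.prod_le_prod (fun j _ => by positivity) fun j _ => ?_
    linarith [hle j]
  have hP1 : 1 ≤ ∏ j ∈ s, (1 + (‖b j‖ / ε) ^ 2) := by
    calc (1 : ℝ) = ∏ j ∈ s, 1 := by simp
      _ ≤ _ := Finset.prod_le_prod (by simp) fun j _ => le_add_of_nonneg_right (sq_nonneg _)
  rw [← Real.log_prod fun j _ => by positivity]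
  apply Real.log_le_log (by positivity)
  rw [← Finset.mul_prod_erase _ _ (Finset.mem_univ m), ← hs, ← hM]
  set P := ∏ j ∈ s, (1 + (‖b j‖ / ε) ^ 2) with hP
  have h1 : (‖B k‖ / ε) ^ 2 ≤ (M / ε) ^ 2 * P := by
    rw [div_pow, div_pow, div_mul_eq_mul_div]
    gcongr
    exact hB2.trans (by gcongr)
  linarith

/-! ### Assembly of the nonlinear inequality -/

/-- The nonlinear Hausdorff–Young inequality for `log (1 + (t / ε) ^ 2)` with `ε` small. -/
theorem exists_log_hausdorffYoung {d : ℕ} (hd : 2 ≤ d) :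
    ∃ ε : ℝ, 0 < ε ∧ ε ≤ 1 ∧ ∀ a b A B : Fin d → ℂ,
      (∀ j, su11Matrix (a j) (b j) ∈ SU11) →
      (∀ k : Fin d, su11Matrix (A k) (B k) = twistedProduct d k a b) →
      ∀ p q : ℝ, p.HolderConjugate q → p ≤ 2 →
        ((1 / (d : ℝ)) * ∑ k : Fin d, Real.log (1 + (‖B k‖ / ε) ^ 2) ^ (q / 2)) ^ (1 / q) ≤
          (∑ j : Fin d, Real.log (1 + (‖b j‖ / ε) ^ 2) ^ (p / 2)) ^ (1 / p) := by
  have hd0 : d ≠ 0 := by omega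
  have hd1 : (1 : ℝ) ≤ d := by exact_mod_cast (by omega : 1 ≤ d)
  have h2d : (1 : ℝ) ≤ 2 ^ d := one_le_pow₀ (by norm_num)
  obtain ⟨C, hC⟩ : ∃ C : ℝ, C = 1 + 2 * 2 ^ d + (2 * d + 1) * d ^ 2 := ⟨_, rfl⟩
  obtain ⟨K, hK⟩ : ∃ K : ℝ, K = 2 * 2 ^ d := ⟨_, rfl⟩
  have hC1 : 1 ≤ C := by
    have : (0 : ℝ) ≤ (2 * d + 1) * d ^ 2 := by positivity
    linarith
  have hK1 : 1 ≤ K := by linarith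
  obtain ⟨ε, c, hε, hc0, hc1, hεc, hdεK, hc, hεC, hεd⟩ := exists_small_parameters hd1 hC1 hK1
  have hεK : ε * K ≤ 1 := (le_mul_of_one_le_left (by positivity) hd1).trans hdεK
  have hε1 : ε ≤ 1 := (le_mul_of_one_le_right hε.le hK1).trans hεK
  refine ⟨ε, hε, hε1, fun a b A B hab hprod p q hpq hp2 => ?_⟩
  have hp1 := hpq.lt
  have hq0 := hpq.symm.pos
  have hlog : ∀ t : ℝ, 0 ≤ Real.log (1 + (t / ε) ^ 2) := fun t =>
    Real.log_nonneg (le_add_of_nonneg_right (sq_nonneg _))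
  have : Nonempty (Fin d) := ⟨⟨0, by omega⟩⟩
  obtain ⟨m, hm⟩ := Finite.exists_max fun j => ‖b j‖
  obtain ⟨l, hls, hl⟩ := Finset.exists_max_image (Finset.univ.erase m) (fun j => ‖b j‖) (by
    rw [← Finset.card_pos, Finset.card_erase_of_mem (Finset.mem_univ m), Finset.card_univ,
      Fintype.card_fin]
    omega)
  have hml : l ≠ m := Finset.ne_of_mem_erase hls
  have hl : ∀ j, j ≠ m → ‖b j‖ ≤ ‖b l‖ := fun j hj =>
    hl j (Finset.mem_erase.2 ⟨hj, Finset.mem_univ j⟩)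
  rcases le_or_gt (K * ε) ‖b l‖ with hbig | hsmall
  · exact power_mean_le_of_le_sum hd0 (fun k => hlog _) (fun j => hlog _)
      (log_one_add_le_sum_of_two_large hab hprod hml hm hε hε1 (hK ▸ hεK) (hK ▸ hbig)) hpq hp2
  -- The case of vanishing `b` is set aside because the slope `log (1 + V) / V` needs `V > 0`.
  rcases (norm_nonneg (b m)).eq_or_lt with hm0 | hmpos
  · have hb0 : ∀ j, ‖b j‖ = 0 := fun j => le_antisymm ((hm j).trans_eq hm0.symm) (norm_nonneg _)
    refine power_mean_le_of_le_sum hd0 (fun k => hlog _) (fun j => hlog _) (fun k => ?_) hpq hp2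
    have hB := norm_le_sinh_sum_arsinh hab hprod k
    simp only [hb0, Real.arsinh_zero, Finset.sum_const_zero, Real.sinh_zero] at hB
    rw [le_antisymm hB (norm_nonneg _)]
    simp only [zero_div, ne_eq, OfNat.ofNat_ne_zero, not_false_eq_true, zero_pow, add_zero,
      Real.log_one]
    exact Finset.sum_nonneg fun j _ => hlog _
  obtain ⟨e, hBe, hem, hej, hej'⟩ := exists_fourier_coeff_twistedProduct hd0 hab hprod
    (norm_nonneg (b l)) (by
      calc (d : ℝ) * ‖b l‖ ≤ d * (K * ε) := by gcongr
        _ = d * (ε * K) := by ring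
        _ ≤ 1 := hdεK) (hm l) hl hC
  obtain ⟨ξ, hξ⟩ : ∃ ξ : Fin d → ℝ, ξ = fun j => ‖b j‖ / ε := ⟨_, rfl⟩
  have hξj : ∀ j, ‖b j‖ = ε * ξ j := fun j => by rw [hξ]; field_simp
  have hξ0 : ∀ j, 0 ≤ ξ j := fun j => by rw [hξ]; positivity
  obtain ⟨V, hV⟩ : ∃ V : ℝ, V = ∑ j, ξ j ^ 2 := ⟨_, rfl⟩
  have hξm : 0 < ξ m := by rw [hξ]; positivity
  have hV0 : 0 < V := by
    have := sq_add_sq_le_sum_sq ξ hml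
    rw [hV]
    exact lt_of_lt_of_le (by positivity) this
  have hsh := inv_one_add_le_log_div hV0
  have hscale : ∀ {x y : ℝ}, x ≤ ε * y → x / ε ≤ y := fun {x y} h => by
    rw [div_le_iff₀ hε]; linarith
  have hξle : ∀ {i j : Fin d}, ‖b i‖ ≤ ‖b j‖ → ξ i ≤ ξ j := fun {i j} h => by
    rw [hξ]; simp only; gcongr
  have hξK : ξ l ≤ K := by
    rw [hξ]; exact hscale (by linarith)
  have hcore : ∑ j, (1 / (1 + V) * (‖e j‖ / ε) ^ 2 +
      ξ j ^ 2 * (Real.log (1 + V) / V - 1 / (1 + V))) ^ (p / 2) ≤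
      ∑ j, Real.log (1 + ξ j ^ 2) ^ (p / 2) := by
    have hγ0 : ∀ j, 0 ≤ ‖e j‖ / ε := fun j => by positivity
    have hγm : ‖e m‖ / ε ≤ ξ m * (1 + C * (ε * ξ l) ^ 2) := by
      apply hscale
      rw [← mul_assoc, ← hξj m, ← hξj l]
      exact hem
    -- Below `c` the coefficients are small perturbations of `b`; above it they need not be, but
    -- then the tangent slope is of order `ε ^ 2`.
    rcases le_or_gt (ε * ξ m) c with hMc | hMc
    · refine sum_rpow_le_of_small hml hξ0 hγ0 hξm (fun j hj => hξle (hl j hj)) (hξle (hm l)) hξK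
        (by linarith) hV hp1.le hp2 hε hγm (fun j hj => hscale ?_) hc1 hMc (by linarith) hc
      have h := hej' (by rw [hξj m]; linarith) j hj
      rw [hξj m, hξj j, hξj l] at h
      linarith
    · refine sum_rpow_le_of_large hml hξ0 hγ0 (fun j hj => hξle (hl j hj)) (hξle (hm l)) hξK hK1
        (by linarith) hV hp1.le hp2 hε hγm (fun j hj => hscale ?_) hc0 hMc.le hεc hεK hεC hεd
      have h := hej j hj
      rw [hξj m, hξj l] at h
      linarith
  have hHY := hausdorffYoung_augmented hd0 (fun j => e j / (ε : ℂ)) (s := 1 / (1 + V))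
    (by positivity) (D := fun j => ξ j ^ 2 * (Real.log (1 + V) / V - 1 / (1 + V)))
    (fun j => mul_nonneg (sq_nonneg _) (by linarith)) hpq hp2
  have hnorm : ∀ z : ℂ, ‖z / (ε : ℂ)‖ = ‖z‖ / ε := fun z => by
    rw [norm_div, Complex.norm_real, Real.norm_of_nonneg hε.le]
  have hsumB : ∀ k : Fin d, ‖∑ j : Fin d, rootChar d j k * (e j / (ε : ℂ))‖ = ‖B k‖ / ε := by
    intro k
    rw [hBe k, ← hnorm, Finset.sum_div]
    congr 1
    exact Finset.sum_congr rfl fun j _ => by ring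
  simp only [hnorm, hsumB, ← Finset.sum_mul, ← hV] at hHY
  calc _ ≤ _ := by
        refine Real.rpow_le_rpow (mul_nonneg (by positivity) (Finset.sum_nonneg fun k _ =>
          Real.rpow_nonneg (hlog _) _)) ?_ (by positivity)
        refine mul_le_mul_of_nonneg_left (Finset.sum_le_sum fun k _ =>
          Real.rpow_le_rpow (hlog _) ?_ (by positivity)) (by positivity)
        have h := log_one_add_le_tangent (sq_nonneg (‖B k‖ / ε)) hV0.le
        refine h.trans_eq ?_
        change _ = 1 / (1 + V) * (‖B k‖ / ε) ^ 2 + V * (Real.log (1 + V) / V - 1 / (1 + V))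
        field_simp
        ring
    _ ≤ _ := hHY
    _ ≤ _ := by
        refine Real.rpow_le_rpow (Finset.sum_nonneg fun j _ => Real.rpow_nonneg (add_nonneg
          (by positivity) (mul_nonneg (sq_nonneg _) (by linarith))) _) ?_ (by positivity)
        simpa only [hξ] using hcore

theorem proposition2 (d : ℕ) (hd : 2 ≤ d) :
    ∃ C : ℝ, 0 < C ∧ ∃ β : ℝ≥0 → ℝ≥0,
      (∀ a b : ℂ, su11Matrix a b ∈ SU11 →
        C⁻¹ * √(Real.log ‖a‖) ≤ (β ‖b‖₊ : ℝ) ∧ (β ‖b‖₊ : ℝ) ≤ C * √(Real.log ‖a‖)) ∧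
      (∀ a b A B : Fin d → ℂ,
        (∀ j, su11Matrix (a j) (b j) ∈ SU11) →
        (∀ k, su11Matrix (A k) (B k) ∈ SU11) →
        (∀ k : Fin d, su11Matrix (A k) (B k) = twistedProduct d k a b) →
        ∀ p q : ℝ, 1 < p → p ≤ 2 → p.HolderConjugate q →
          ((1 / (d : ℝ)) * ∑ k : Fin d, (β ‖B k‖₊ : ℝ) ^ q) ^ (1 / q) ≤
            (∑ j : Fin d, (β ‖b j‖₊ : ℝ) ^ p) ^ (1 / p)) := by
  obtain ⟨ε, hε, hε1, hHY⟩ := exists_log_hausdorffYoung hd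
  have hlog : ∀ t : ℝ, 0 ≤ Real.log (1 + (t / ε) ^ 2) := fun t =>
    Real.log_nonneg (le_add_of_nonneg_right (sq_nonneg _))
  obtain ⟨β, hβ⟩ : ∃ β : ℝ≥0 → ℝ≥0, ∀ t, (β t : ℝ) = ε * √(Real.log (1 + ((t : ℝ) / ε) ^ 2)) :=
    ⟨fun t => (ε * √(Real.log (1 + ((t : ℝ) / ε) ^ 2))).toNNReal,
      fun t => Real.coe_toNNReal _ (by positivity)⟩
  refine ⟨2 / ε, by positivity, β, ?_, ?_⟩
  · intro a b hab
    have hab := norm_sq_sub_of_mem_SU11 hab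
    have ha1 : 1 ≤ ‖a‖ := by nlinarith [norm_nonneg a, sq_nonneg ‖b‖]
    have hL : Real.log (1 + ‖b‖ ^ 2) = 2 * Real.log ‖a‖ := by
      rw [show 1 + ‖b‖ ^ 2 = ‖a‖ ^ 2 by linarith, Real.log_pow]
      norm_num
    have hL0 : 0 ≤ Real.log ‖a‖ := Real.log_nonneg ha1
    simp only [hβ, coe_nnnorm]
    have hlow : Real.log ‖a‖ ≤ Real.log (1 + (‖b‖ / ε) ^ 2) := by
      calc Real.log ‖a‖ ≤ Real.log (1 + ‖b‖ ^ 2) := by linarith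
        _ ≤ _ := by
          gcongr
          exact le_div_self (norm_nonneg _) hε hε1
    have hup : ε ^ 2 * Real.log (1 + (‖b‖ / ε) ^ 2) ≤ 2 * Real.log ‖a‖ := by
      rw [← hL, ← Real.log_rpow (by positivity)]
      apply Real.log_le_log (by positivity)
      -- Bernoulli's inequality with exponent `ε ^ 2 ≤ 1` undoes the rescaling: `(1 + |b|²/ε²) ^
      -- (ε²) ≤ 1 + |b|²`.
      have := rpow_one_add_le_one_add_mul_self (s := (‖b‖ / ε) ^ 2)
        (le_trans (by norm_num) (sq_nonneg _)) (p := ε ^ 2) (by positivity)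
        (pow_le_one₀ hε.le hε1)
      refine this.trans_eq ?_
      field_simp
    constructor
    · calc (2 / ε)⁻¹ * √(Real.log ‖a‖) ≤ ε * √(Real.log ‖a‖) := by
            gcongr
            rw [inv_div]
            linarith
        _ ≤ _ := by gcongr
    · calc ε * √(Real.log (1 + (‖b‖ / ε) ^ 2)) = √(ε ^ 2 * Real.log (1 + (‖b‖ / ε) ^ 2)) := by
            rw [Real.sqrt_mul (by positivity), Real.sqrt_sq hε.le]
        _ ≤ √(2 ^ 2 * Real.log ‖a‖) := by
            apply Real.sqrt_le_sqrt
            linarith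
        _ = 2 * √(Real.log ‖a‖) := by
            rw [Real.sqrt_mul (by positivity), Real.sqrt_sq (by norm_num)]
        _ ≤ 2 / ε * √(Real.log ‖a‖) := by
            gcongr
            exact le_div_self (by norm_num) hε hε1
  · intro a b A B hab _ hprod p q _ hp2 hpq
    have hp0 := hpq.pos
    have hq0 := hpq.symm.pos
    have hpow : ∀ {r : ℝ} (t : ℝ), (ε * √(Real.log (1 + (t / ε) ^ 2))) ^ r =
        ε ^ r * Real.log (1 + (t / ε) ^ 2) ^ (r / 2) := by
      intro r t
      rw [Real.mul_rpow hε.le (Real.sqrt_nonneg _), Real.sqrt_eq_rpow, ← Real.rpow_mul (hlog t)]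
      congr 2
      ring
    have hfactor : ∀ {r x : ℝ}, 0 < r → 0 ≤ x → (ε ^ r * x) ^ (1 / r) = ε * x ^ (1 / r) := by
      intro r x hr hx
      rw [Real.mul_rpow (by positivity) hx, ← Real.rpow_mul hε.le, mul_one_div_cancel hr.ne',
        Real.rpow_one]
    simp only [hβ, coe_nnnorm, hpow, ← Finset.mul_sum]
    rw [mul_left_comm, hfactor hq0 (mul_nonneg (by positivity) (Finset.sum_nonneg fun k _ =>
      Real.rpow_nonneg (hlog _) _)), hfactor hp0 (Finset.sum_nonneg fun j _ =>
      Real.rpow_nonneg (hlog _) _)]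
    exact mul_le_mul_of_nonneg_left (hHY a b A B hab hprod p q hpq hp2) hε.le
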